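/- **Conventions.** Work in local coordinates; Latin indices run over $1,\dots,n$, Greek indices over $1,\dots,n-1$, repeated indices are summed, $\partial_i=\partial/\partial x^i$, $\dot\partial_i=\partial/\partial y^i$. Let $D$ be an open set of line elements $(x,y)$, $y\neq0$, with $(x,ty)\in D$ for $(x,y)\in D$, $t>0$. A Finsler metric on $D$ is a smooth function $L(x,y)>0$ on $D$, positively homogeneous of degree $1$ in $y$, with $g_{ij}=\tfrac12\dot\partial_i\dot\partial_jL^2$ nondegenerate. Put $h_{ij}=L\dot\partial_i\dot\partial_jL$, $C_{ijk}=\tfrac12\dot\partial_kg_{ij}$, $C^i_{jk}=g^{ir}C_{rjk}$, $G^i=\tfrac14g^{ir}(y^k\partial_k\dot\partial_rL^2-\partial_rL^2)$, $G^i_j=\dot\partial_jG^i$, $\delta_j=\partial_j-G^h_j\dot\partial_h$ and $F^i_{jk}=\tfrac12g^{ir}(\delta_jg_{rk}+\delta_kg_{rj}-\delta_rg_{jk})$; $(F^i_{jk},G^i_j,C^i_{jk})$ is the Cartan connection of $F^n=(D,L)$. For a covector field $b_i(x,y)$ put $b_{i|j}=\partial_jb_i-(\dot\partial_hb_i)G^h_j-F^r_{ij}b_r$,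 $b_i|_j=\dot\partial_jb_i-C^r_{ij}b_r$ and $b_{i|0}=b_{i|j}y^j$. A smooth $b_i(x,y)$ on $D$ is an *h-vector* of $F^n$ if $b_i|_k=0$ and $L\,C^h_{ij}b_h=\rho\,h_{ij}$ for some nowhere vanishing scalar $\rho$ on $D$; it is a *gradient* if $b_{i|j}=b_{j|i}$. The *Kropina change* of $L$ by $b_i$ is ${}^*L=L^2/(b_iy^i)$; objects formed from ${}^*L$ carry an asterisk. **Hypersurfaces.** Let $x^i=x^i(u^\alpha)$ be a smooth parametrized hypersurface with $B^i_\alpha=\partial x^i/\partial u^\alpha$ of rank $n-1$. Its line elements are the pairs $(u,v)$ with $(x(u),y)\in D$, where $y^i=B^i_\alpha v^\alpha$; with the metric $L(x(u),B_\alpha v^\alpha)$ it is denoted $F^{n-1}$. Let $N^i(u,v)$ be a smooth unit normal: $g_{ij}B^i_\alpha N^j=0$, $g_{ij}N^iN^j=1$. Put $N_i=g_{ij}N^j$, $g_{\alpha\beta}=g_{ij}B^i_\alpha B^j_\beta$, $B^\alpha_i=g^{\alpha\beta}g_{ij}B^j_\beta$, $B^i_{\alpha\beta}=\partial^2x^i/\partial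 u^\alpha\partial u^\beta$, $B^i_{0\alpha}=B^i_{\beta\alpha}v^\beta$, $H_\alpha=N_i(B^i_{0\alpha}+G^i_jB^j_\alpha)$ and $M_{\alpha\beta}=C_{ijk}B^i_\alpha B^j_\beta N^k$. The induced Cartan connection has coefficients $G^\alpha_\beta=B^\alpha_i(B^i_{0\beta}+G^i_jB^j_\beta)$ and $F^\alpha_{\beta\gamma}=B^\alpha_i(B^i_{\beta\gamma}+F^i_{jk}B^j_\beta B^k_\gamma)+g^{\alpha\varepsilon}M_{\varepsilon\beta}H_\gamma$. An *h-path* of a connection $(F^i_{jk},G^i_j)$ is a curve of line elements $(x(t),y(t))$ with $\ddot x^i+F^i_{jk}(x,y)\dot x^j\dot x^k=0$ and $\dot y^i+G^i_j(x,y)\dot x^j=0$. $F^{n-1}$ is a *hyperplane of the second kind* if for every h-path $(u(t),v(t))$ of the induced Cartan connection, the curve $x^i(u(t))$, $y^i=B^i_\alpha v^\alpha$ is an h-path of the Cartan connection of $F^n$. $F^{n-1}$ is a *hyperplane of the third kind* if its unit normal is parallel along every curve $(u(t),v(t))$ of its line elements, i.e. $\frac{dN^i}{dt}+F^i_{jk}N^j\dot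 x^k+C^i_{jk}N^j(\dot y^k+G^k_l\dot x^l)=0$ with $x=x(u(t))$, $y^i=B^i_\alpha v^\alpha$. **Theorem.** Let $L$ be a Finsler metric on $D$, $b_i$ an h-vector of $F^n=(D,L)$, and suppose that ${}^*L=L^2/(b_iy^i)$ is a Finsler metric on $D$. Let $F^{n-1}$ and ${}^*F^{n-1}$ be the hypersurfaces of $(D,L)$ and $(D,{}^*L)$ given by the same equations $x^i=x^i(u^\alpha)$, with smooth unit normals $N^i$ and ${}^*N^i$. Suppose that $b_i$ is a gradient, is tangent to $F^{n-1}$ (that is, $b_i(x(u),B_\alpha v^\alpha)N^i(u,v)=0$ for all line elements $(u,v)$ of $F^{n-1}$), and satisfies $b_{r|0}\,C^r_{ij}=0$ on $D$. Then: 1. if $F^{n-1}$ is a hyperplane of the second kind and $M_{\alpha\beta}=0$, then ${}^*F^{n-1}$ is a hyperplane of the second kind; 2. if $F^{n-1}$ is a hyperplane of the third kind, then ${}^*F^{n-1}$ is a hyperplane of the third kind. -/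

import Mathlib

open scoped ContDiff

noncomputable section

namespace Finsler

/-- Coordinate vectors: points `x`, supporting elements `y`, parameters `u`, and so on. -/
abbrev Vec (n : ℕ) := Fin n → ℝ

/-- A function `f(x, y)` of a point `x` and a supporting element `y`. -/
abbrev ScalarField (n : ℕ) := Vec n → Vec n → ℝ

/-! ### Finsler spaces and the Cartan connection, in coordinates -/

section Ambient

variable {n : ℕ}

/-- `∂f/∂xⁱ`. -/
def dx (f : ScalarField n) (i : Fin n) : ScalarField n :=
  fun x y => fderiv ℝ (fun z => f z y) x (Pi.single i 1)

/-- `∂f/∂yⁱ`. -/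
def dy (f : ScalarField n) (i : Fin n) : ScalarField n :=
  fun x y => fderiv ℝ (fun z => f x z) y (Pi.single i 1)

/-- `g_ij = ½ ∂²L²/∂yⁱ∂yʲ`. -/
def metric (L : ScalarField n) (i j : Fin n) : ScalarField n :=
  fun x y => (1 / 2) * dy (dy (fun x y => L x y ^ 2) j) i x y

/-- The matrix `(g_ij)`. -/
def metricMatrix (L : ScalarField n) (x y : Vec n) : Matrix (Fin n) (Fin n) ℝ :=
  Matrix.of fun i j => metric L i j x y

/-- `g^ij`, the entries of the inverse matrix of `(g_ij)`. -/
def metricInv (L : ScalarField n) (i j : Fin n) : ScalarField n :=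
  fun x y => (metricMatrix L x y)⁻¹ i j

/-- The angular metric tensor `h_ij = L ∂²L/∂yⁱ∂yʲ`. -/
def angular (L : ScalarField n) (i j : Fin n) : ScalarField n :=
  fun x y => L x y * dy (dy L j) i x y

/-- The Cartan tensor `C_ijk = ½ ∂g_ij/∂yᵏ`. -/
def cartanC (L : ScalarField n) (i j k : Fin n) : ScalarField n :=
  fun x y => (1 / 2) * dy (metric L i j) k x y

/-- `C^i_jk = g^ir C_rjk`. -/
def cartanCUp (L : ScalarField n) (i j k : Fin n) : ScalarField n :=
  fun x y => ∑ r, metricInv L i r x y * cartanC L r j k x y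

/-- The spray coefficients
`Gⁱ = ¼ g^ir (yᵏ ∂²L²/∂xᵏ∂yʳ - ∂L²/∂xʳ)`, so that geodesics satisfy `ẍⁱ + 2Gⁱ(x, ẋ) = 0`. -/
def spray (L : ScalarField n) (i : Fin n) : ScalarField n :=
  fun x y => (1 / 4) * ∑ r, metricInv L i r x y *
    ((∑ k, y k * dx (dy (fun x y => L x y ^ 2) r) k x y) - dx (fun x y => L x y ^ 2) r x y)

/-- The nonlinear connection `G^i_j = ∂Gⁱ/∂yʲ`. -/
def nonlinConn (L : ScalarField n) (i j : Fin n) : ScalarField n :=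
  dy (spray L i) j

/-- `δ_j f = ∂f/∂xʲ - G^h_j ∂f/∂yʰ`. -/
def delta (L f : ScalarField n) (j : Fin n) : ScalarField n :=
  fun x y => dx f j x y - ∑ h, nonlinConn L h j x y * dy f h x y

/-- The horizontal coefficients of the Cartan connection:
`F^i_jk = ½ g^ir (δ_j g_rk + δ_k g_rj - δ_r g_jk)`. -/
def cartanF (L : ScalarField n) (i j k : Fin n) : ScalarField n :=
  fun x y => (1 / 2) * ∑ r, metricInv L i r x y *
    (delta L (metric L r k) j x y + delta L (metric L r j) k x y - delta L (metric L j k) r x y)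

/-- The h-covariant derivative
`b_{i|j} = ∂b_i/∂xʲ - (∂b_i/∂yʰ) G^h_j - F^r_ij b_r` of a covariant vector. -/
def hCov (L : ScalarField n) (b : Vec n → Vec n → Vec n) (i j : Fin n) : ScalarField n :=
  fun x y => dx (fun x y => b x y i) j x y
    - (∑ h, dy (fun x y => b x y i) h x y * nonlinConn L h j x y)
    - ∑ r, cartanF L r i j x y * b x y r

/-- The v-covariant derivative `b_i|_j = ∂b_i/∂yʲ - C^r_ij b_r` of a covariant vector. -/
def vCov (L : ScalarField n) (b : Vec n → Vec n → Vec n) (i j : Fin n) : ScalarField n :=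
  fun x y => dy (fun x y => b x y i) j x y - ∑ r, cartanCUp L r i j x y * b x y r

/-- `L` is a (regular) Finsler metric function on the domain `D` of line elements `(x, y)`:
`D` is open and conic without zero vectors, `L` is smooth, positive and positively homogeneous
of degree one in `y`, and `(g_ij)` is nondegenerate. -/
structure IsFinslerMetric (D : Set (Vec n × Vec n)) (L : ScalarField n) : Prop where
  isOpen : IsOpen D
  ne_zero : ∀ x y, (x, y) ∈ D → y ≠ 0
  conic : ∀ x y, (x, y) ∈ D → ∀ t : ℝ, 0 < t → (x, t • y) ∈ D
  smooth : ContDiffOn ℝ ∞ (fun p : Vec n × Vec n => L p.1 p.2) D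
  pos : ∀ x y, (x, y) ∈ D → 0 < L x y
  homogeneous : ∀ x y, (x, y) ∈ D → ∀ t : ℝ, 0 < t → L x (t • y) = t * L x y
  regular : ∀ x y, (x, y) ∈ D → (metricMatrix L x y).det ≠ 0

/-- `b_i(x, y)` is an h-vector of the Finsler space `(D, L)`:
`b_i|_k = 0` and `L C^h_ij b_h = ρ h_ij` for a nowhere vanishing scalar `ρ`. -/
def IsHVector (D : Set (Vec n × Vec n)) (L : ScalarField n) (b : Vec n → Vec n → Vec n) : Prop :=
  ContDiffOn ℝ ∞ (fun p : Vec n × Vec n => b p.1 p.2) D ∧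
  (∀ x y, (x, y) ∈ D → ∀ i k, vCov L b i k x y = 0) ∧
  ∃ ρ : ScalarField n, ∀ x y, (x, y) ∈ D → ρ x y ≠ 0 ∧
    ∀ i j, L x y * ∑ h, cartanCUp L h i j x y * b x y h = ρ x y * angular L i j x y

/-- `b_i` is a gradient: `b_{i|j} = b_{j|i}`. -/
def IsGradient (D : Set (Vec n × Vec n)) (L : ScalarField n) (b : Vec n → Vec n → Vec n) : Prop :=
  ∀ x y, (x, y) ∈ D → ∀ i j, hCov L b i j x y = hCov L b j i x y

/-- The Kropina change `*L = L² / (b_i yⁱ)`. -/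
def kropina (L : ScalarField n) (b : Vec n → Vec n → Vec n) : ScalarField n :=
  fun x y => L x y ^ 2 / ∑ i, b x y i * y i

/-- `t ↦ (x(t), y(t))`, `a < t < c`, is an h-path in the domain `D` for a connection with
coefficients `(F^i_jk, G^i_j)`: the supporting element `y` is parallel along `x`, and the
velocity of `x` is h-parallel with respect to `y`:
`ẍⁱ + F^i_jk(x, y) ẋʲ ẋᵏ = 0` and `ẏⁱ + G^i_j(x, y) ẋʲ = 0`. -/
structure IsHPath (D : Set (Vec n × Vec n)) (F : Fin n → Fin n → Fin n → ScalarField n)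
    (G : Fin n → Fin n → ScalarField n) (a c : ℝ) (x y : ℝ → Vec n) : Prop where
  mem : ∀ t ∈ Set.Ioo a c, (x t, y t) ∈ D
  differentiable_x : ∀ t ∈ Set.Ioo a c, DifferentiableAt ℝ x t
  differentiable_velocity : ∀ t ∈ Set.Ioo a c, DifferentiableAt ℝ (deriv x) t
  differentiable_y : ∀ t ∈ Set.Ioo a c, DifferentiableAt ℝ y t
  path_eq : ∀ t ∈ Set.Ioo a c, ∀ i, deriv (deriv x) t i
    + ∑ j, ∑ k, F i j k (x t) (y t) * deriv x t j * deriv x t k = 0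
  parallel_eq : ∀ t ∈ Set.Ioo a c, ∀ i, deriv y t i
    + ∑ j, G i j (x t) (y t) * deriv x t j = 0

end Ambient

/-! ### Hypersurfaces `xⁱ = xⁱ(u^α)` -/

section Hypersurface

variable {m : ℕ}

/-- The projection factors `B^i_α = ∂xⁱ/∂u^α`. -/
def proj (X : Vec m → Vec (m + 1)) (i : Fin (m + 1)) (α : Fin m) (u : Vec m) : ℝ :=
  fderiv ℝ (fun w => X w i) u (Pi.single α 1)

/-- `B^i_αβ = ∂²xⁱ/∂u^α∂u^β`. -/
def proj₂ (X : Vec m → Vec (m + 1)) (i : Fin (m + 1)) (α β : Fin m) (u : Vec m) : ℝ :=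
  fderiv ℝ (proj X i β) u (Pi.single α 1)

/-- The supporting element `yⁱ = B^i_α v^α`. -/
def push (X : Vec m → Vec (m + 1)) (u v : Vec m) : Vec (m + 1) :=
  fun i => ∑ α, proj X i α u * v α

/-- A smooth parametrized hypersurface with projection factors of rank `n - 1 = m`. -/
structure IsHypersurface (U : Set (Vec m)) (X : Vec m → Vec (m + 1)) : Prop where
  isOpen : IsOpen U
  smooth : ContDiffOn ℝ ∞ X U
  rank_eq : ∀ u ∈ U, (Matrix.of fun i α => proj X i α u).rank = m

/-- The line elements `(u, v)` of the hypersurface, whose supporting elements lie in `D`. -/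
def lineElements (D : Set (Vec (m + 1) × Vec (m + 1))) (U : Set (Vec m))
    (X : Vec m → Vec (m + 1)) : Set (Vec m × Vec m) :=
  {p | p.1 ∈ U ∧ (X p.1, push X p.1 p.2) ∈ D}

/-- `N^i(u, v)` is a smooth unit normal field along the hypersurface:
`g_ij B^i_α Nʲ = 0` and `g_ij Nⁱ Nʲ = 1`. -/
structure IsUnitNormal (L : ScalarField (m + 1)) (D : Set (Vec (m + 1) × Vec (m + 1)))
    (U : Set (Vec m)) (X : Vec m → Vec (m + 1)) (N : Vec m → Vec m → Vec (m + 1)) : Prop where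
  smooth : ContDiffOn ℝ ∞ (fun p : Vec m × Vec m => N p.1 p.2) (lineElements D U X)
  normal : ∀ u v, (u, v) ∈ lineElements D U X → ∀ α,
    ∑ i, ∑ j, metric L i j (X u) (push X u v) * proj X i α u * N u v j = 0
  unit : ∀ u v, (u, v) ∈ lineElements D U X →
    ∑ i, ∑ j, metric L i j (X u) (push X u v) * N u v i * N u v j = 1

/-- The induced metric tensor `g_αβ = g_ij B^i_α B^j_β`, as a matrix. -/
def inducedMetric (L : ScalarField (m + 1)) (X : Vec m → Vec (m + 1)) (u v : Vec m) :
    Matrix (Fin m) (Fin m) ℝ :=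
  Matrix.of fun α β => ∑ i, ∑ j, metric L i j (X u) (push X u v) * proj X i α u * proj X j β u

/-- The inverse projection factors `B^α_i = g^αβ g_ij B^j_β`. -/
def invProj (L : ScalarField (m + 1)) (X : Vec m → Vec (m + 1)) (α : Fin m) (i : Fin (m + 1))
    (u v : Vec m) : ℝ :=
  ∑ β, ∑ j, (inducedMetric L X u v)⁻¹ α β * metric L i j (X u) (push X u v) * proj X j β u

/-- The covariant components `N_i = g_ij Nʲ`. -/
def conormal (L : ScalarField (m + 1)) (X : Vec m → Vec (m + 1))
    (N : Vec m → Vec m → Vec (m + 1)) (i : Fin (m + 1)) (u v : Vec m) : ℝ :=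
  ∑ j, metric L i j (X u) (push X u v) * N u v j

/-- `B^i_0α + G^i_j B^j_α`, where `B^i_0α = B^i_βα v^β`. -/
def secondOrder₀ (L : ScalarField (m + 1)) (X : Vec m → Vec (m + 1)) (i : Fin (m + 1))
    (α : Fin m) (u v : Vec m) : ℝ :=
  (∑ β, proj₂ X i β α u * v β) + ∑ j, nonlinConn L i j (X u) (push X u v) * proj X j α u

/-- `B^i_αβ + F^i_jk B^j_α B^k_β`. -/
def secondOrder (L : ScalarField (m + 1)) (X : Vec m → Vec (m + 1)) (i : Fin (m + 1))
    (α β : Fin m) (u v : Vec m) : ℝ :=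
  proj₂ X i α β u
    + ∑ j, ∑ k, cartanF L i j k (X u) (push X u v) * proj X j α u * proj X k β u

/-- The normal curvature vector `H_α = N_i (B^i_0α + G^i_j B^j_α)`. -/
def normalCurv (L : ScalarField (m + 1)) (X : Vec m → Vec (m + 1))
    (N : Vec m → Vec m → Vec (m + 1)) (α : Fin m) (u v : Vec m) : ℝ :=
  ∑ i, conormal L X N i u v * secondOrder₀ L X i α u v

/-- The second fundamental v-tensor `M_αβ = C_ijk B^i_α B^j_β Nᵏ`. -/
def vTensor (L : ScalarField (m + 1)) (X : Vec m → Vec (m + 1))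
    (N : Vec m → Vec m → Vec (m + 1)) (α β : Fin m) (u v : Vec m) : ℝ :=
  ∑ i, ∑ j, ∑ k, cartanC L i j k (X u) (push X u v) * proj X i α u * proj X j β u * N u v k

/-- The induced nonlinear connection `G^α_β = B^α_i (B^i_0β + G^i_j B^j_β)`. -/
def inducedG (L : ScalarField (m + 1)) (X : Vec m → Vec (m + 1)) (α β : Fin m) :
    ScalarField m :=
  fun u v => ∑ i, invProj L X α i u v * secondOrder₀ L X i β u v

/-- The horizontal coefficients of the induced Cartan connection:
`F^α_βγ = B^α_i (B^i_βγ + F^i_jk B^j_β B^k_γ) + M^α_β H_γ`, where `M^α_β = g^αε M_εβ`. -/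
def inducedF (L : ScalarField (m + 1)) (X : Vec m → Vec (m + 1))
    (N : Vec m → Vec m → Vec (m + 1)) (α β γ : Fin m) : ScalarField m :=
  fun u v => (∑ i, invProj L X α i u v * secondOrder L X i β γ u v)
    + (∑ ε, (inducedMetric L X u v)⁻¹ α ε * vTensor L X N ε β u v) * normalCurv L X N γ u v

/-- The hypersurface is a hyperplane of the second kind: each h-path of the hypersurface with
respect to the induced Cartan connection is also an h-path of the ambient Finsler space. -/
def IsHyperplaneSecondKind (L : ScalarField (m + 1)) (D : Set (Vec (m + 1) × Vec (m + 1)))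
    (U : Set (Vec m)) (X : Vec m → Vec (m + 1)) (N : Vec m → Vec m → Vec (m + 1)) : Prop :=
  ∀ (a c : ℝ) (u v : ℝ → Vec m),
    IsHPath (lineElements D U X) (inducedF L X N) (inducedG L X) a c u v →
    IsHPath D (cartanF L) (nonlinConn L) a c (fun t => X (u t)) (fun t => push X (u t) (v t))

/-- The hypersurface is a hyperplane of the third kind: its unit normal is parallel, with respect
to the Cartan connection of the ambient space, along each curve of line elements
`t ↦ (u(t), v(t))` of the hypersurface, that is, for `xⁱ = xⁱ(u(t))` and `yⁱ = B^i_α v^α(t)`,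
`dNⁱ/dt + F^i_jk Nʲ ẋᵏ + C^i_jk Nʲ (ẏᵏ + G^k_l ẋˡ) = 0`. -/
def IsHyperplaneThirdKind (L : ScalarField (m + 1)) (D : Set (Vec (m + 1) × Vec (m + 1)))
    (U : Set (Vec m)) (X : Vec m → Vec (m + 1)) (N : Vec m → Vec m → Vec (m + 1)) : Prop :=
  ∀ (a c : ℝ) (u v : ℝ → Vec m),
    (∀ t ∈ Set.Ioo a c, (u t, v t) ∈ lineElements D U X ∧
      DifferentiableAt ℝ u t ∧ DifferentiableAt ℝ v t) →
    ∀ t ∈ Set.Ioo a c, ∀ i,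
      deriv (fun s => N (u s) (v s) i) t
      + (∑ j, ∑ k, cartanF L i j k (X (u t)) (push X (u t) (v t)) * N (u t) (v t) j
          * deriv (fun s => X (u s) k) t)
      + (∑ j, ∑ k, cartanCUp L i j k (X (u t)) (push X (u t) (v t)) * N (u t) (v t) j
          * (deriv (fun s => push X (u s) (v s) k) t
            + ∑ l, nonlinConn L k l (X (u t)) (push X (u t) (v t))
                * deriv (fun s => X (u s) l) t)) = 0

end Hypersurface

end Finsler

end

/-!
Both kinds of hyperplane reduce to one condition that hardly depends on the metric. Write
`E = L²/2`, let `B = dX` be the differential of the hypersurface and `N` its unit normal. The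
condition `IsFlatAlong` says that, on all line elements of the hypersurface, the normal curvature
vector `H_α` and the second fundamental v-tensor `M_αβ` vanish.

* `H_α = 0` already follows from `H_0 = 0`, that is, from tangency of `∂²X(v, v) + 2G`: the tangent
  space does not depend on `v`, so one may differentiate in `v` (`isFlatAlong_of_spray`).
* `H_α = 0` and `M_αβ = 0` force the second fundamental h-tensor to vanish
  (`IsFlatAlong.metricForm_secondFundamental`). A second `v`-derivative gives the statement for the
  Berwald coefficients `G^i_jk`; these differ from `F^i_jk` by the Landsberg tensor `C_{ijk|0}`
  (`two_mul_metricForm_berwald_sub_cartan`), whose component on two tangents and the normal is the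
  derivative of `M_αβ` along the spray, which is tangent to the hypersurface.
* Hence `IsFlatAlong` implies both the second and the third kind. Conversely the third kind implies
  it, by looking at `B`-components of the covariant derivative of `N` along straight parameter
  curves, and so does the second kind together with `M_αβ = 0`, because h-paths of the induced
  connection exist with arbitrary initial data.

It remains to see that the Kropina change preserves the condition (`IsFlatAlong.kropina`). With
`β = b_i yⁱ` and `θ = E/β` the new energy is `2θ²`. An h-vector satisfies `b_i = ∂̇_i β`, and the
Hessian of `β` is proportional to the angular metric. Two properties of a function are stable under
products and quotients: that its `y`-derivatives of order at most three vanish when one slot is `N`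
and the others are tangent (`IsTransversallyFlat`), and that it satisfies the `N`-component of the
Euler–Lagrange equation along the spray of `L` (`IsStationary`). Both hold for `E`, by `M_αβ = 0`
and by definition of the spray, and for `β`, by tangency and the gradient condition. So they hold
for the new energy. The first shows that the two unit normals are proportional and that the new
`M_αβ` vanishes, the second that the two sprays differ by a tangent vector, so the new `H_0`
vanishes.
-/

noncomputable section

-- needed to find the norm on trilinear forms
set_option maxSynthPendingDepth 3

namespace Finsler

/-! ### Derivatives on the space of line elements -/

section Calculus

variable {n : ℕ} {W : Type*} [NormedAddCommGroup W] [NormedSpace ℝ W]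
  {D : Set (Vec n × Vec n)} {f : Vec n × Vec n → W} {p : Vec n × Vec n}

/-- The derivative of `f(x, y)` in the supporting element `y`. -/
def vderiv (f : Vec n × Vec n → W) (p : Vec n × Vec n) : Vec n →L[ℝ] W :=
  (fderiv ℝ f p).comp (ContinuousLinearMap.inr ℝ (Vec n) (Vec n))

@[simp] lemma vderiv_apply (a : Vec n) : vderiv f p a = fderiv ℝ f p (0, a) := by
  simp [vderiv]

lemma fderiv_split (a b : Vec n) :
    fderiv ℝ f p (a, b) = fderiv ℝ f p (a, 0) + fderiv ℝ f p (0, b) := by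
  rw [← map_add]; simp

lemma hasFDerivAt_of_smooth (hD : IsOpen D) (hf : ContDiffOn ℝ ∞ f D) (hp : p ∈ D) :
    HasFDerivAt f (fderiv ℝ f p) p :=
  ((hf.contDiffAt (hD.mem_nhds hp)).differentiableAt (by simp)).hasFDerivAt

lemma contDiffOn_fderiv (hD : IsOpen D) (hf : ContDiffOn ℝ ∞ f D) :
    ContDiffOn ℝ ∞ (fderiv ℝ f) D :=
  hf.fderiv_of_isOpen hD (by simp)

lemma contDiffOn_vderiv (hD : IsOpen D) (hf : ContDiffOn ℝ ∞ f D) :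
    ContDiffOn ℝ ∞ (vderiv f) D :=
  (contDiffOn_fderiv hD hf).clm_comp contDiffOn_const

lemma fderiv_vderiv (hD : IsOpen D) (hf : ContDiffOn ℝ ∞ f D) (hp : p ∈ D)
    (q : Vec n × Vec n) (a : Vec n) :
    fderiv ℝ (vderiv f) p q a = fderiv ℝ (fderiv ℝ f) p q (0, a) := by
  have h := hasFDerivAt_of_smooth hD (contDiffOn_fderiv hD hf) hp
  have := (h.clm_comp (hasFDerivAt_const
    (ContinuousLinearMap.inr ℝ (Vec n) (Vec n)) p)).fderiv
  have e : vderiv f = fun p => (fderiv ℝ f p).comp (ContinuousLinearMap.inr ℝ (Vec n) (Vec n)) :=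
    rfl
  rw [e, this]
  simp

lemma fderiv_fderiv_comm (hD : IsOpen D) (hf : ContDiffOn ℝ ∞ f D) (hp : p ∈ D)
    (q r : Vec n × Vec n) :
    fderiv ℝ (fderiv ℝ f) p q r = fderiv ℝ (fderiv ℝ f) p r q :=
  ((hf.contDiffAt (hD.mem_nhds hp)).isSymmSndFDerivAt
    (by rw [minSmoothness_of_isRCLikeNormedField]; exact WithTop.coe_le_coe.2 le_top)).eq q r

lemma fderiv_apply_const {W' : Type*} [NormedAddCommGroup W'] [NormedSpace ℝ W']
    {f : Vec n × Vec n → W' →L[ℝ] W} (hD : IsOpen D) (hf : ContDiffOn ℝ ∞ f D)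
    (hp : p ∈ D) (c : W') (q : Vec n × Vec n) :
    fderiv ℝ (fun p' => f p' c) p q = fderiv ℝ f p q c := by
  rw [((hasFDerivAt_of_smooth hD hf hp).clm_apply (hasFDerivAt_const c p)).fderiv]
  simp

lemma vderiv_vderiv_comm (hD : IsOpen D) (hf : ContDiffOn ℝ ∞ f D) (hp : p ∈ D) (a b : Vec n) :
    vderiv (vderiv f) p a b = vderiv (vderiv f) p b a := by
  rw [vderiv_apply, vderiv_apply, fderiv_vderiv hD hf hp, fderiv_vderiv hD hf hp,
    fderiv_fderiv_comm hD hf hp]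

lemma fderiv_congr_of_isOpen {f g : Vec n × Vec n → W} (hD : IsOpen D)
    (h : ∀ q ∈ D, f q = g q) (hp : p ∈ D) : fderiv ℝ f p = fderiv ℝ g p :=
  (Filter.eventuallyEq_of_mem (hD.mem_nhds hp) h).fderiv_eq

lemma fderiv_two_mul {f : Vec n × Vec n → ℝ} (hD : IsOpen D) (hf : ContDiffOn ℝ ∞ f D)
    (hp : p ∈ D) (q : Vec n × Vec n) :
    fderiv ℝ (fun p' => 2 * f p') p q = 2 * fderiv ℝ f p q := by
  rw [((hasFDerivAt_of_smooth hD hf hp).const_mul 2).fderiv]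
  simp

lemma dy_eq {f : ScalarField n} {g : Vec n × Vec n → ℝ} (hD : IsOpen D)
    (hg : ContDiffOn ℝ ∞ g D) (h : ∀ q ∈ D, f q.1 q.2 = g q) (hp : p ∈ D) (i : Fin n) :
    dy f i p.1 p.2 = fderiv ℝ g p (0, Pi.single i 1) := by
  have hf : HasFDerivAt (fun q : Vec n × Vec n => f q.1 q.2) (fderiv ℝ g p) p :=
    (hasFDerivAt_of_smooth hD hg hp).congr_of_eventuallyEq
      (Filter.eventuallyEq_of_mem (hD.mem_nhds hp) h)
  have hpair : HasFDerivAt (fun z : Vec n => (p.1, z))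
      (ContinuousLinearMap.inr ℝ (Vec n) (Vec n)) p.2 :=
    hasFDerivAt_prodMk_right p.1 p.2
  have := HasFDerivAt.comp (f := fun z : Vec n => (p.1, z)) p.2 hf hpair
  have e : fderiv ℝ (fun z => f p.1 z) p.2 = _ := this.fderiv
  rw [dy, e]
  simp

lemma dx_eq {f : ScalarField n} {g : Vec n × Vec n → ℝ} (hD : IsOpen D)
    (hg : ContDiffOn ℝ ∞ g D) (h : ∀ q ∈ D, f q.1 q.2 = g q) (hp : p ∈ D) (i : Fin n) :
    dx f i p.1 p.2 = fderiv ℝ g p (Pi.single i 1, 0) := by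
  have hf : HasFDerivAt (fun q : Vec n × Vec n => f q.1 q.2) (fderiv ℝ g p) p :=
    (hasFDerivAt_of_smooth hD hg hp).congr_of_eventuallyEq
      (Filter.eventuallyEq_of_mem (hD.mem_nhds hp) h)
  have hpair : HasFDerivAt (fun z : Vec n => (z, p.2))
      (ContinuousLinearMap.inl ℝ (Vec n) (Vec n)) p.1 :=
    hasFDerivAt_prodMk_left p.1 p.2
  have := HasFDerivAt.comp (f := fun z : Vec n => (z, p.2)) p.1 hf hpair
  have e : fderiv ℝ (fun z => f z p.2) p.1 = _ := this.fderiv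
  rw [dx, e]
  simp

lemma clm_eq_sum {F : Type*} [AddCommMonoid F] [TopologicalSpace F] [Module ℝ F]
    (l : Vec n →L[ℝ] F) (a : Vec n) :
    l a = ∑ i, a i • l (Pi.single i 1) := by
  conv_lhs => rw [pi_eq_sum_univ' a, map_sum]
  refine Finset.sum_congr rfl fun i _ => ?_
  rw [map_smul]

/-- Entries of the inverse of a smooth family of invertible matrices are smooth. -/
lemma contDiffOn_matrix_inv {ι V : Type*} [Fintype ι] [DecidableEq ι] [NormedAddCommGroup V]
    [NormedSpace ℝ V] {S : Set V} {A : V → Matrix ι ι ℝ}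
    (hA : ∀ i j, ContDiffOn ℝ ∞ (fun s => A s i j) S) (hdet : ∀ s ∈ S, (A s).det ≠ 0) (i j : ι) :
    ContDiffOn ℝ ∞ (fun s => (A s)⁻¹ i j) S := by
  have det_smooth : ∀ {B : V → Matrix ι ι ℝ}, (∀ i j, ContDiffOn ℝ ∞ (fun s => B s i j) S) →
      ContDiffOn ℝ ∞ (fun s => (B s).det) S := by
    intro B hB
    simp only [Matrix.det_apply]
    exact ContDiffOn.sum fun σ _ => (contDiffOn_prod fun k _ => hB _ _).const_smul _
  have hadj : ContDiffOn ℝ ∞ (fun s => (A s).adjugate i j) S := by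
    simp only [Matrix.adjugate_apply]
    refine det_smooth fun k l => ?_
    simp only [Matrix.updateRow_apply]
    split_ifs
    · exact contDiffOn_const
    · exact hA k l
  have : (fun s => (A s)⁻¹ i j) = fun s => ((A s).det)⁻¹ * (A s).adjugate i j := by
    ext s
    rw [Matrix.inv_def, Matrix.smul_apply, smul_eq_mul, Ring.inverse_eq_inv']
  rw [this]
  exact ((det_smooth hA).inv hdet).mul hadj

end Calculus

/-! ### The fundamental tensor and the Cartan connection as multilinear maps -/

section Metric

variable {n : ℕ} {D : Set (Vec n × Vec n)} {L : ScalarField n} {p : Vec n × Vec n}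

/-- The energy `E = L²/2`. -/
def energy (L : ScalarField n) (p : Vec n × Vec n) : ℝ := L p.1 p.2 ^ 2 / 2

/-- The fundamental tensor as a bilinear form, `g(a, b) = g_ij aⁱ bʲ = ∂²E/∂y²(a, b)`. -/
def metricForm (L : ScalarField n) : Vec n × Vec n → Vec n →L[ℝ] Vec n →L[ℝ] ℝ :=
  vderiv (vderiv (energy L))

/-- The vertical derivative of the fundamental tensor: twice the Cartan tensor,
`2 C_ijk aⁱ bʲ cᵏ`. -/
def cartanForm (L : ScalarField n) : Vec n × Vec n → Vec n →L[ℝ] Vec n →L[ℝ] Vec n →L[ℝ] ℝ :=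
  vderiv (metricForm L)

/-- The spray coefficients as a vector-valued function on line elements. -/
def sprayVec (L : ScalarField n) (p : Vec n × Vec n) : Vec n := fun i => spray L i p.1 p.2

/-- The nonlinear connection as a linear map, `(G a)ⁱ = G^i_j aʲ`. -/
def connForm (L : ScalarField n) : Vec n × Vec n → Vec n →L[ℝ] Vec n := vderiv (sprayVec L)

/-- The horizontal lift `a ↦ (a, -G a)`, so that `δ_j f = df(hlift e_j)`. -/
def hlift (L : ScalarField n) (p : Vec n × Vec n) : Vec n →L[ℝ] Vec n × Vec n :=
  (ContinuousLinearMap.id ℝ (Vec n)).prod (-connForm L p)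

/-- The vector `F^i_jk aʲ bᵏ`. -/
def cartanFVec (L : ScalarField n) (p : Vec n × Vec n) (a b : Vec n) : Vec n :=
  fun i => ∑ j, ∑ k, cartanF L i j k p.1 p.2 * a j * b k

/-- The vector `C^i_jk aʲ bᵏ`. -/
def cartanCVec (L : ScalarField n) (p : Vec n × Vec n) (a b : Vec n) : Vec n :=
  fun i => ∑ j, ∑ k, cartanCUp L i j k p.1 p.2 * a j * b k

@[simp] lemma hlift_apply (a : Vec n) : hlift L p a = (a, -connForm L p a) := by
  simp [hlift]

lemma bilin_eq_sum (l : Vec n →L[ℝ] Vec n →L[ℝ] ℝ) (a b : Vec n) :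
    l a b = ∑ i, ∑ j, l (Pi.single i 1) (Pi.single j 1) * a i * b j := by
  rw [clm_eq_sum l a, sum_apply]
  refine Finset.sum_congr rfl fun i _ => ?_
  rw [smul_apply, clm_eq_sum _ b, Finset.smul_sum]
  refine Finset.sum_congr rfl fun j _ => ?_
  simp only [smul_eq_mul]
  ring

lemma trilin_eq_sum (l : Vec n →L[ℝ] Vec n →L[ℝ] Vec n →L[ℝ] ℝ) (a b c : Vec n) :
    l a b c = ∑ i, ∑ j, ∑ k,
      l (Pi.single i 1) (Pi.single j 1) (Pi.single k 1) * a i * b j * c k := by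
  rw [clm_eq_sum l a]
  simp only [sum_apply, smul_apply]
  refine Finset.sum_congr rfl fun i _ => ?_
  rw [bilin_eq_sum _ b c, Finset.smul_sum]
  refine Finset.sum_congr rfl fun j _ => ?_
  rw [Finset.smul_sum]
  refine Finset.sum_congr rfl fun k _ => ?_
  simp only [smul_eq_mul]
  ring

lemma sum_rotate {ι κ : Type*} [Fintype ι] [Fintype κ] (f : ι → ι → κ → ℝ) :
    ∑ i, ∑ j, ∑ k, f i j k = ∑ k, ∑ i, ∑ j, f i j k := by
  simp_rw [Finset.sum_comm (f := fun j k => f _ j k)]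
  rw [Finset.sum_comm]

namespace IsFinslerMetric

variable (hL : IsFinslerMetric D L)
include hL

lemma energy_smooth : ContDiffOn ℝ ∞ (energy L) D :=
  (hL.smooth.pow 2).div_const 2

lemma metricForm_smooth : ContDiffOn ℝ ∞ (metricForm L) D :=
  contDiffOn_vderiv hL.isOpen (contDiffOn_vderiv hL.isOpen hL.energy_smooth)

lemma cartanForm_smooth : ContDiffOn ℝ ∞ (cartanForm L) D :=
  contDiffOn_vderiv hL.isOpen hL.metricForm_smooth

lemma dy_sq (hp : p ∈ D) (j : Fin n) :
    dy (fun x y => L x y ^ 2) j p.1 p.2 = 2 * vderiv (energy L) p (Pi.single j 1) := by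
  rw [dy_eq hL.isOpen (contDiffOn_const.mul hL.energy_smooth) (fun q _ => ?_) hp,
    fderiv_two_mul hL.isOpen hL.energy_smooth hp]
  · rw [vderiv_apply]
  · simp only [energy]; ring

lemma dx_sq (hp : p ∈ D) (j : Fin n) :
    dx (fun x y => L x y ^ 2) j p.1 p.2 = 2 * fderiv ℝ (energy L) p (Pi.single j 1, 0) := by
  rw [dx_eq hL.isOpen (contDiffOn_const.mul hL.energy_smooth) (fun q _ => ?_) hp,
    fderiv_two_mul hL.isOpen hL.energy_smooth hp]
  simp only [energy]; ring

lemma vderiv_energy_smooth (c : Vec n) :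
    ContDiffOn ℝ ∞ (fun q => vderiv (energy L) q c) D :=
  (contDiffOn_vderiv hL.isOpen hL.energy_smooth).clm_apply contDiffOn_const

lemma metric_eq (hp : p ∈ D) (i j : Fin n) :
    metric L i j p.1 p.2 = metricForm L p (Pi.single i 1) (Pi.single j 1) := by
  rw [metric, dy_eq hL.isOpen (contDiffOn_const.mul (hL.vderiv_energy_smooth (Pi.single j 1)))
    (fun q hq => hL.dy_sq hq j) hp, fderiv_two_mul hL.isOpen (hL.vderiv_energy_smooth _) hp,
    fderiv_apply_const hL.isOpen (contDiffOn_vderiv hL.isOpen hL.energy_smooth) hp, metricForm,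
    vderiv_apply]
  ring

lemma dx_dy_sq (hp : p ∈ D) (j k : Fin n) :
    dx (dy (fun x y => L x y ^ 2) j) k p.1 p.2
      = 2 * fderiv ℝ (vderiv (energy L)) p (Pi.single k 1, 0) (Pi.single j 1) := by
  rw [dx_eq hL.isOpen (contDiffOn_const.mul (hL.vderiv_energy_smooth (Pi.single j 1)))
    (fun q hq => hL.dy_sq hq j) hp, fderiv_two_mul hL.isOpen (hL.vderiv_energy_smooth _) hp,
    fderiv_apply_const hL.isOpen (contDiffOn_vderiv hL.isOpen hL.energy_smooth) hp]

lemma metric_entry_smooth (i j : Fin n) : ContDiffOn ℝ ∞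
    (fun q => metricForm L q (Pi.single i 1) (Pi.single j 1)) D :=
  (hL.metricForm_smooth.clm_apply contDiffOn_const).clm_apply contDiffOn_const

lemma cartanC_eq (hp : p ∈ D) (i j k : Fin n) :
    cartanC L i j k p.1 p.2
      = 1 / 2 * cartanForm L p (Pi.single k 1) (Pi.single i 1) (Pi.single j 1) := by
  rw [cartanC, dy_eq hL.isOpen (hL.metric_entry_smooth i j) (fun q hq => hL.metric_eq hq i j) hp,
    fderiv_apply_const hL.isOpen (hL.metricForm_smooth.clm_apply contDiffOn_const) hp,
    fderiv_apply_const hL.isOpen hL.metricForm_smooth hp, cartanForm, vderiv_apply]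

lemma metricForm_symm (hp : p ∈ D) (a b : Vec n) : metricForm L p a b = metricForm L p b a :=
  vderiv_vderiv_comm hL.isOpen hL.energy_smooth hp a b

lemma fderiv_metricForm_symm (hp : p ∈ D) (q : Vec n × Vec n) (a b : Vec n) :
    fderiv ℝ (metricForm L) p q a b = fderiv ℝ (metricForm L) p q b a := by
  have h := hL.metricForm_smooth
  have h1 : ∀ c : Vec n, ContDiffOn ℝ ∞ (fun q => metricForm L q c) D := fun c =>
    h.clm_apply contDiffOn_const
  rw [← fderiv_apply_const hL.isOpen h hp a, ← fderiv_apply_const hL.isOpen h hp b,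
    ← fderiv_apply_const hL.isOpen (h1 a) hp b, ← fderiv_apply_const hL.isOpen (h1 b) hp a]
  rw [fderiv_congr_of_isOpen hL.isOpen (fun q hq => hL.metricForm_symm hq a b) hp]

lemma cartanForm_symm₂₃ (hp : p ∈ D) (a b c : Vec n) :
    cartanForm L p a b c = cartanForm L p a c b := by
  simp only [cartanForm, vderiv_apply]
  exact hL.fderiv_metricForm_symm hp _ b c

lemma cartanForm_symm₁₂ (hp : p ∈ D) (a b c : Vec n) :
    cartanForm L p a b c = cartanForm L p b a c := by
  have := vderiv_vderiv_comm hL.isOpen (contDiffOn_vderiv hL.isOpen hL.energy_smooth) hp a b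
  exact congrArg (fun l => l c) this

lemma sum_metric (hp : p ∈ D) (a b : Vec n) :
    ∑ i, ∑ j, metric L i j p.1 p.2 * a i * b j = metricForm L p a b := by
  rw [bilin_eq_sum]
  simp only [hL.metric_eq hp]

lemma metricForm_mulVec (hp : p ∈ D) (a b : Vec n) :
    metricForm L p a b = a ⬝ᵥ (metricMatrix L p.1 p.2).mulVec b := by
  rw [← hL.sum_metric hp]
  simp only [dotProduct, Matrix.mulVec, metricMatrix, Matrix.of_apply, Finset.mul_sum]
  refine Finset.sum_congr rfl fun i _ => Finset.sum_congr rfl fun j _ => ?_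
  ring

lemma metricForm_nondeg (hp : p ∈ D) {b : Vec n} (h : ∀ a, metricForm L p a b = 0) : b = 0 := by
  refine Matrix.eq_zero_of_mulVec_eq_zero (hL.regular p.1 p.2 hp) ?_
  ext i
  have := h (Pi.single i 1)
  rw [hL.metricForm_mulVec hp] at this
  simpa using this

lemma metricInv_smooth (i j : Fin n) :
    ContDiffOn ℝ ∞ (fun q : Vec n × Vec n => metricInv L i j q.1 q.2) D := by
  refine contDiffOn_matrix_inv (A := fun q : Vec n × Vec n => metricMatrix L q.1 q.2)
    (fun i j => ?_) (fun q hq => hL.regular q.1 q.2 hq) i j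
  exact (hL.metric_entry_smooth i j).congr fun q hq => hL.metric_eq hq i j

/-- Lowering an index that was raised with `g^ir`. -/
lemma metricForm_raise (hp : p ∈ D) {s R : Vec n}
    (hs : ∀ i, s i = ∑ r, metricInv L i r p.1 p.2 * R r) (a : Vec n) :
    metricForm L p s a = ∑ r, R r * a r := by
  have hs' : s = (metricMatrix L p.1 p.2)⁻¹.mulVec R := by
    ext i; rw [hs]; rfl
  rw [hL.metricForm_symm hp, hL.metricForm_mulVec hp, hs', Matrix.mulVec_mulVec,
    Matrix.mul_nonsing_inv _ (isUnit_iff_ne_zero.2 (hL.regular p.1 p.2 hp)), Matrix.one_mulVec]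
  exact Finset.sum_congr rfl fun i _ => mul_comm _ _

/-- The defining equation of the spray, `2 g(G, a) = ∂_y ∂̇_a E - ∂_a E`. -/
lemma metricForm_spray (hp : p ∈ D) (a : Vec n) :
    2 * metricForm L p (sprayVec L p) a
      = fderiv ℝ (vderiv (energy L)) p (p.2, 0) a - fderiv ℝ (energy L) p (a, 0) := by
  have h := hL.metricForm_raise hp (s := sprayVec L p)
    (R := fun r => 1 / 2 * (fderiv ℝ (vderiv (energy L)) p (p.2, 0) (Pi.single r 1)
      - fderiv ℝ (energy L) p (Pi.single r 1, 0))) (fun i => ?_) a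
  · rw [h, clm_eq_sum (fderiv ℝ (vderiv (energy L)) p (p.2, 0)) a]
    have : fderiv ℝ (energy L) p (a, 0)
        = ((fderiv ℝ (energy L) p).comp (ContinuousLinearMap.inl ℝ _ _)) a := by simp
    rw [this, clm_eq_sum _ a, ← Finset.sum_sub_distrib, Finset.mul_sum]
    refine Finset.sum_congr rfl fun r _ => ?_
    simp only [smul_eq_mul, ContinuousLinearMap.comp_apply, ContinuousLinearMap.inl_apply]
    ring
  · rw [sprayVec, spray, Finset.mul_sum]
    refine Finset.sum_congr rfl fun r _ => ?_
    have : fderiv ℝ (vderiv (energy L)) p (p.2, 0) (Pi.single r 1)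
        = ((fderiv ℝ (vderiv (energy L)) p).comp (ContinuousLinearMap.inl ℝ _ _)) p.2
          (Pi.single r 1) := by simp
    rw [this, clm_eq_sum _ p.2, sum_apply]
    simp only [hL.dx_sq hp, hL.dx_dy_sq hp, smul_apply,
      ContinuousLinearMap.comp_apply, ContinuousLinearMap.inl_apply, smul_eq_mul]
    rw [show ∀ S T u : ℝ, u * (1 / 2 * (S - T)) = 1 / 4 * (u * (2 * S - 2 * T)) by intros; ring,
      Finset.mul_sum]
    congr 4
    funext k
    ring

lemma dx_sq_smooth (r : Fin n) : ContDiffOn ℝ ∞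
    (fun q : Vec n × Vec n => dx (fun x y => L x y ^ 2) r q.1 q.2) D :=
  (contDiffOn_const.mul ((contDiffOn_fderiv hL.isOpen hL.energy_smooth).clm_apply
    contDiffOn_const)).congr fun _ hq => hL.dx_sq hq r

lemma dx_dy_sq_smooth (j k : Fin n) : ContDiffOn ℝ ∞
    (fun q : Vec n × Vec n => dx (dy (fun x y => L x y ^ 2) j) k q.1 q.2) D :=
  (contDiffOn_const.mul (((contDiffOn_fderiv hL.isOpen
    (contDiffOn_vderiv hL.isOpen hL.energy_smooth)).clm_apply
    contDiffOn_const).clm_apply contDiffOn_const)).congr fun _ hq => hL.dx_dy_sq hq j k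

lemma sprayVec_smooth : ContDiffOn ℝ ∞ (sprayVec L) D := by
  refine contDiffOn_pi.2 fun i => ?_
  refine contDiffOn_const.mul (ContDiffOn.sum fun r _ => (hL.metricInv_smooth i r).mul
    (ContDiffOn.sub (ContDiffOn.sum fun k _ => ?_) (hL.dx_sq_smooth r)))
  refine ContDiffOn.mul ?_ (hL.dx_dy_sq_smooth r k)
  exact (contDiff_apply ℝ ℝ k |>.comp contDiff_snd).contDiffOn

lemma connForm_smooth : ContDiffOn ℝ ∞ (connForm L) D :=
  contDiffOn_vderiv hL.isOpen hL.sprayVec_smooth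

lemma hlift_smooth : ContDiffOn ℝ ∞ (fun q => hlift L q) D := by
  have : (fun q => hlift L q) = fun q => ContinuousLinearMap.inl ℝ (Vec n) (Vec n)
      - (ContinuousLinearMap.inr ℝ (Vec n) (Vec n)).comp (connForm L q) := by
    ext q a : 2
    simp
  rw [this]
  exact contDiffOn_const.sub (contDiffOn_const.clm_comp hL.connForm_smooth)

lemma nonlinConn_eq (hp : p ∈ D) (i j : Fin n) :
    nonlinConn L i j p.1 p.2 = connForm L p (Pi.single j 1) i := by
  have h : ContDiffOn ℝ ∞ (fun q => sprayVec L q i) D := contDiffOn_pi.1 hL.sprayVec_smooth i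
  rw [nonlinConn, dy_eq hL.isOpen h (fun q _ => rfl) hp, connForm, vderiv_apply]
  have := hasFDerivAt_pi'.1 (hasFDerivAt_of_smooth hL.isOpen hL.sprayVec_smooth hp) i
  rw [this.fderiv]
  simp

lemma sum_nonlinConn (hp : p ∈ D) (i : Fin n) (a : Vec n) :
    ∑ j, nonlinConn L i j p.1 p.2 * a j = connForm L p a i := by
  rw [clm_eq_sum _ a, Finset.sum_apply]
  exact Finset.sum_congr rfl fun j _ => by
    rw [hL.nonlinConn_eq hp, Pi.smul_apply, smul_eq_mul, mul_comm]

lemma delta_eq {f : ScalarField n} {g : Vec n × Vec n → ℝ}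
    (hg : ContDiffOn ℝ ∞ g D) (h : ∀ q ∈ D, f q.1 q.2 = g q) (hp : p ∈ D) (j : Fin n) :
    delta L f j p.1 p.2 = fderiv ℝ g p (hlift L p (Pi.single j 1)) := by
  rw [delta, dx_eq hL.isOpen hg h hp, hlift_apply,
    fderiv_split (Pi.single j 1) (-connForm L p (Pi.single j 1)), sub_eq_add_neg]
  congr 1
  have : fderiv ℝ g p (0, -connForm L p (Pi.single j 1))
      = -((fderiv ℝ g p).comp (ContinuousLinearMap.inr ℝ _ _)) (connForm L p (Pi.single j 1)) := by
    simp [← map_neg]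
  rw [this, clm_eq_sum]
  congr 1
  refine Finset.sum_congr rfl fun h' _ => ?_
  rw [dy_eq hL.isOpen hg h hp, hL.nonlinConn_eq hp]
  simp

lemma delta_metric_eq (hp : p ∈ D) (i j k : Fin n) :
    delta L (metric L i j) k p.1 p.2 = fderiv ℝ (metricForm L) p (hlift L p (Pi.single k 1))
      (Pi.single i 1) (Pi.single j 1) := by
  rw [hL.delta_eq (hL.metric_entry_smooth i j) (fun q hq => hL.metric_eq hq i j) hp,
    fderiv_apply_const hL.isOpen (hL.metricForm_smooth.clm_apply contDiffOn_const) hp,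
    fderiv_apply_const hL.isOpen hL.metricForm_smooth hp]

lemma cartanF_smooth (i j k : Fin n) :
    ContDiffOn ℝ ∞ (fun q : Vec n × Vec n => cartanF L i j k q.1 q.2) D := by
  have hd : ∀ i j k : Fin n, ContDiffOn ℝ ∞
      (fun q : Vec n × Vec n => delta L (metric L i j) k q.1 q.2) D := fun i j k =>
    ((((contDiffOn_fderiv hL.isOpen hL.metricForm_smooth).clm_apply
      (hL.hlift_smooth.clm_apply contDiffOn_const)).clm_apply contDiffOn_const).clm_apply
      contDiffOn_const).congr fun q hq => hL.delta_metric_eq hq i j k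
  exact contDiffOn_const.mul (ContDiffOn.sum fun r _ => (hL.metricInv_smooth i r).mul
    (((hd r k j).add (hd r j k)).sub (hd j k r)))

lemma nonlinConn_smooth (i j : Fin n) :
    ContDiffOn ℝ ∞ (fun q : Vec n × Vec n => nonlinConn L i j q.1 q.2) D :=
  (contDiffOn_pi.1 (hL.connForm_smooth.clm_apply contDiffOn_const) i).congr
    fun _ hq => hL.nonlinConn_eq hq i j

lemma cartanF_symm (hp : p ∈ D) (i j k : Fin n) :
    cartanF L i j k p.1 p.2 = cartanF L i k j p.1 p.2 := by
  simp only [cartanF, hL.delta_metric_eq hp]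
  congr 1
  refine Finset.sum_congr rfl fun r _ => ?_
  rw [hL.fderiv_metricForm_symm hp _ (Pi.single j 1) (Pi.single k 1)]
  ring

lemma cartanFVec_symm (hp : p ∈ D) (a b : Vec n) :
    cartanFVec L p a b = cartanFVec L p b a := by
  ext i
  simp only [cartanFVec]
  rw [Finset.sum_comm]
  refine Finset.sum_congr rfl fun j _ => Finset.sum_congr rfl fun k _ => ?_
  rw [hL.cartanF_symm hp i k j]
  ring

/-- The Christoffel formula for the horizontal coefficients. -/
lemma two_mul_metricForm_cartanF (hp : p ∈ D) (a b c : Vec n) :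
    2 * metricForm L p (cartanFVec L p a b) c
      = fderiv ℝ (metricForm L) p (hlift L p a) b c + fderiv ℝ (metricForm L) p (hlift L p b) a c
        - fderiv ℝ (metricForm L) p (hlift L p c) a b := by
  have h := hL.metricForm_raise hp (s := cartanFVec L p a b)
    (R := fun r => ∑ j, ∑ k, 1 / 2 * (delta L (metric L r k) j p.1 p.2
      + delta L (metric L r j) k p.1 p.2 - delta L (metric L j k) r p.1 p.2) * a j * b k)
      (fun i => ?_) c
  · set l := (fderiv ℝ (metricForm L) p).comp (hlift L p) with hl
    have e1 := trilin_eq_sum l a b c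
    have e2 := trilin_eq_sum l b a c
    have e3 := trilin_eq_sum l c a b
    simp only [hl, ContinuousLinearMap.comp_apply] at e1 e2 e3
    rw [h, e1, e2, e3]
    rw [sum_rotate]
    rw [sum_rotate fun i j k => fderiv ℝ (metricForm L) p (hlift L p (Pi.single i 1))
      (Pi.single j 1) (Pi.single k 1) * b i * a j * c k]
    simp_rw [Finset.sum_comm (f := fun i j => fderiv ℝ (metricForm L) p
      (hlift L p (Pi.single i 1)) (Pi.single j 1) (Pi.single _ 1) * b i * a j * c _)]
    simp only [← Finset.sum_add_distrib, ← Finset.sum_sub_distrib, Finset.mul_sum, Finset.sum_mul]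
    refine Finset.sum_congr rfl fun r _ => Finset.sum_congr rfl fun j _ =>
      Finset.sum_congr rfl fun k _ => ?_
    rw [hL.delta_metric_eq hp, hL.delta_metric_eq hp, hL.delta_metric_eq hp,
      hL.fderiv_metricForm_symm hp _ (Pi.single r 1) (Pi.single k 1),
      hL.fderiv_metricForm_symm hp _ (Pi.single r 1) (Pi.single j 1)]
    ring
  · simp only [cartanFVec, cartanF, Finset.mul_sum, Finset.sum_mul]
    rw [Finset.sum_comm' (t' := Finset.univ) (s' := fun _ => Finset.univ) (by simp)]
    conv_lhs => enter [2, j]; rw [Finset.sum_comm]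
    rw [Finset.sum_comm]
    refine Finset.sum_congr rfl fun r _ => ?_
    rw [Finset.sum_comm]
    refine Finset.sum_congr rfl fun j _ => Finset.sum_congr rfl fun k _ => ?_
    ring

/-- The connection is metrical: `g_{ij|k} = 0`. -/
lemma fderiv_metricForm_hlift (hp : p ∈ D) (a b c : Vec n) :
    fderiv ℝ (metricForm L) p (hlift L p c) a b
      = metricForm L p (cartanFVec L p a c) b + metricForm L p a (cartanFVec L p b c) := by
  have h1 := hL.two_mul_metricForm_cartanF hp a c b
  have h2 := hL.two_mul_metricForm_cartanF hp b c a
  rw [hL.metricForm_symm hp a]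
  have := hL.fderiv_metricForm_symm hp (hlift L p c) a b
  have := hL.fderiv_metricForm_symm hp (hlift L p a) c b
  have := hL.fderiv_metricForm_symm hp (hlift L p b) c a
  linarith

/-- `2 g(C(a, b), c) = ∂̇_a g(b, c)`. -/
lemma two_mul_metricForm_cartanC (hp : p ∈ D) (a b c : Vec n) :
    2 * metricForm L p (cartanCVec L p a b) c = cartanForm L p a b c := by
  have h := hL.metricForm_raise hp (s := cartanCVec L p a b)
    (R := fun r => ∑ j, ∑ k, cartanC L r j k p.1 p.2 * a j * b k) (fun i => ?_) c
  · rw [h, trilin_eq_sum, sum_rotate, Finset.mul_sum]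
    simp only [Finset.sum_mul, Finset.mul_sum]
    refine Finset.sum_congr rfl fun r _ => Finset.sum_congr rfl fun j _ =>
      Finset.sum_congr rfl fun k _ => ?_
    rw [hL.cartanC_eq hp, hL.cartanForm_symm₂₃ hp, hL.cartanForm_symm₁₂ hp]
    ring
  · simp only [cartanCVec, cartanCUp, Finset.mul_sum, Finset.sum_mul]
    conv_lhs => enter [2, j]; rw [Finset.sum_comm]
    rw [Finset.sum_comm]
    refine Finset.sum_congr rfl fun r _ => Finset.sum_congr rfl fun j _ =>
      Finset.sum_congr rfl fun k _ => ?_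
    ring

end IsFinslerMetric

end Metric

/-! ### Positively homogeneous functions -/

section Homogeneous

variable {n : ℕ} {W : Type*} [NormedAddCommGroup W] [NormedSpace ℝ W]
  {D : Set (Vec n × Vec n)} {f : Vec n × Vec n → W} {p : Vec n × Vec n}

/-- `f(x, y)` is positively homogeneous of degree `k` in `y` on `D`. -/
def IsHomogeneousOn (D : Set (Vec n × Vec n)) (k : ℕ) (f : Vec n × Vec n → W) : Prop :=
  ∀ p ∈ D, ∀ t : ℝ, 0 < t → f (p.1, t • p.2) = t ^ k • f p

lemma IsHomogeneousOn.fderiv_smul {k : ℕ} (h : IsHomogeneousOn D k f) (hD : IsOpen D)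
    (hcone : ∀ x y, (x, y) ∈ D → ∀ t : ℝ, 0 < t → (x, t • y) ∈ D)
    (hf : ContDiffOn ℝ ∞ f D) (hp : p ∈ D) {t : ℝ} (ht : 0 < t) (a b : Vec n) :
    fderiv ℝ f (p.1, t • p.2) (a, t • b) = t ^ k • fderiv ℝ f p (a, b) := by
  set σ : Vec n × Vec n →L[ℝ] Vec n × Vec n :=
    (ContinuousLinearMap.fst ℝ _ _).prod (t • ContinuousLinearMap.snd ℝ _ _) with hσ
  have h1 : HasFDerivAt f (fderiv ℝ f (σ p)) (σ p) :=
    hasFDerivAt_of_smooth hD hf (hcone _ _ hp t ht)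
  have h2 : HasFDerivAt (f ∘ σ) ((fderiv ℝ f (σ p)).comp σ) p := h1.comp p σ.hasFDerivAt
  have h3 := ((hasFDerivAt_of_smooth hD hf hp).const_smul (t ^ k)).congr_of_eventuallyEq
    (f₁ := f ∘ σ) (Filter.eventuallyEq_of_mem (hD.mem_nhds hp) fun q hq => h q hq t ht)
  exact congrArg (fun l => l (a, b)) (h2.unique h3)

lemma IsHomogeneousOn.vderiv {k : ℕ} (h : IsHomogeneousOn D (k + 1) f) (hD : IsOpen D)
    (hcone : ∀ x y, (x, y) ∈ D → ∀ t : ℝ, 0 < t → (x, t • y) ∈ D)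
    (hf : ContDiffOn ℝ ∞ f D) : IsHomogeneousOn D k (vderiv f) := by
  intro p hp t ht
  ext a : 1
  have := h.fderiv_smul hD hcone hf hp ht 0 a
  rw [show ((0 : Vec n), t • a) = t • ((0 : Vec n), a) by simp, map_smul, pow_succ',
    mul_smul] at this
  exact smul_right_injective W ht.ne' this

/-- Euler's identity. -/
lemma IsHomogeneousOn.euler {k : ℕ} (h : IsHomogeneousOn D k f) (hD : IsOpen D)
    (hf : ContDiffOn ℝ ∞ f D) (hp : p ∈ D) : Finsler.vderiv f p p.2 = (k : ℝ) • f p := by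
  have h1 : HasDerivAt (fun t : ℝ => (p.1, t • p.2)) ((0 : Vec n), p.2) 1 := by
    simpa using (hasDerivAt_const (1 : ℝ) p.1).prodMk ((hasDerivAt_id (1 : ℝ)).smul_const p.2)
  have h2 : HasDerivAt (fun t : ℝ => f (p.1, t • p.2)) (fderiv ℝ f p (0, p.2)) 1 := by
    refine HasFDerivAt.comp_hasDerivAt (f := fun t : ℝ => (p.1, t • p.2)) (1 : ℝ) ?_ h1
    simpa using hasFDerivAt_of_smooth hD hf hp
  have h3 : HasDerivAt (fun t : ℝ => f (p.1, t • p.2)) ((k : ℝ) • f p) 1 := by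
    have := (hasDerivAt_pow k (1 : ℝ)).smul_const (f p)
    simp only [one_pow, mul_one] at this
    exact this.congr_of_eventuallyEq
      (Filter.eventuallyEq_of_mem (Ioi_mem_nhds one_pos) fun t ht => h p hp t ht)
  rw [vderiv_apply]
  exact h2.unique h3

end Homogeneous

/-! ### Identities for the spray and the Landsberg tensor -/

section SprayIdentities

variable {n : ℕ} {D : Set (Vec n × Vec n)} {L : ScalarField n} {p : Vec n × Vec n}

/-- The direction `(y, -2G)` of the geodesic spray. -/
def sprayDir (L : ScalarField n) (p : Vec n × Vec n) : Vec n × Vec n :=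
  (p.2, -((2 : ℝ) • sprayVec L p))

/-- The derivative `2 C_{abc|0}` of twice the Cartan tensor along the spray. -/
def landsberg (L : ScalarField n) (p : Vec n × Vec n) (a b c : Vec n) : ℝ :=
  fderiv ℝ (cartanForm L) p (sprayDir L p) a b c - cartanForm L p (connForm L p a) b c
    - cartanForm L p a (connForm L p b) c - cartanForm L p a b (connForm L p c)

namespace IsFinslerMetric

variable (hL : IsFinslerMetric D L)
include hL

lemma energy_homogeneous : IsHomogeneousOn D 2 (energy L) := by
  intro p hp t ht
  simp only [energy, hL.homogeneous p.1 p.2 hp t ht, smul_eq_mul]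
  ring

lemma vderiv_energy_homogeneous : IsHomogeneousOn D 1 (vderiv (energy L)) :=
  hL.energy_homogeneous.vderiv hL.isOpen hL.conic hL.energy_smooth

lemma metricForm_homogeneous : IsHomogeneousOn D 0 (metricForm L) :=
  hL.vderiv_energy_homogeneous.vderiv hL.isOpen hL.conic
    (contDiffOn_vderiv hL.isOpen hL.energy_smooth)

lemma metricForm_self (hp : p ∈ D) (a : Vec n) :
    metricForm L p p.2 a = vderiv (energy L) p a := by
  have := hL.vderiv_energy_homogeneous.euler hL.isOpen
    (contDiffOn_vderiv hL.isOpen hL.energy_smooth) hp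
  rw [Nat.cast_one, one_smul] at this
  exact congrArg (fun l => l a) this

lemma cartanForm_self (hp : p ∈ D) : cartanForm L p p.2 = 0 := by
  have := hL.metricForm_homogeneous.euler hL.isOpen hL.metricForm_smooth hp
  rwa [Nat.cast_zero, zero_smul] at this

lemma sprayVec_homogeneous : IsHomogeneousOn D 2 (sprayVec L) := by
  intro p hp t ht
  have hp' := hL.conic p.1 p.2 hp t ht
  rw [← sub_eq_zero]
  refine hL.metricForm_nondeg hp' fun a => ?_
  have h1 := hL.metricForm_spray hp' a
  have h2 := hL.metricForm_spray hp a
  have h3 := hL.energy_homogeneous.fderiv_smul hL.isOpen hL.conic hL.energy_smooth hp ht a 0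
  have h4 := hL.vderiv_energy_homogeneous.fderiv_smul hL.isOpen hL.conic
    (contDiffOn_vderiv hL.isOpen hL.energy_smooth) hp ht p.2 0
  have h5 := hL.metricForm_homogeneous p hp t ht
  rw [smul_zero] at h3 h4
  rw [show (t • p.2, (0 : Vec n)) = t • (p.2, (0 : Vec n)) by simp, map_smul, h4, h3] at h1
  rw [hL.metricForm_symm hp', map_sub, sub_apply]
  rw [h5, pow_zero, one_smul] at h1 ⊢
  simp only [map_smul, smul_apply, smul_eq_mul] at h1 ⊢
  linear_combination (1 / 2) * h1 - t ^ 2 / 2 * h2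

lemma connForm_self (hp : p ∈ D) : connForm L p p.2 = (2 : ℝ) • sprayVec L p :=
  hL.sprayVec_homogeneous.euler hL.isOpen hL.sprayVec_smooth hp

lemma hlift_self (hp : p ∈ D) : hlift L p p.2 = sprayDir L p := by
  rw [hlift_apply, hL.connForm_self hp, sprayDir]

lemma hasFDerivAt_metricForm (hp : p ∈ D) :
    HasFDerivAt (metricForm L) (fderiv ℝ (metricForm L) p) p :=
  hasFDerivAt_of_smooth hL.isOpen hL.metricForm_smooth hp

/-- The `y`-derivative of the defining equation of the spray. -/
lemma two_mul_metricForm_conn (hp : p ∈ D) (a b : Vec n) :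
    2 * metricForm L p (connForm L p b) a
      = fderiv ℝ (metricForm L) p (sprayDir L p) b a + fderiv ℝ (vderiv (energy L)) p (b, 0) a
        - fderiv ℝ (vderiv (energy L)) p (a, 0) b := by
  have hO := hL.isOpen
  have hE := hL.energy_smooth
  have hE1 := contDiffOn_vderiv hO hE
  have h1 := fderiv_congr_of_isOpen hO (fun q hq => hL.metricForm_spray hq a) hp
  have d1 := ((((hL.hasFDerivAt_metricForm hp).clm_apply
    (hasFDerivAt_of_smooth hO hL.sprayVec_smooth hp)).clm_apply
    (hasFDerivAt_const a p)).const_mul 2).fderiv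
  have d2 := ((((hasFDerivAt_of_smooth hO (contDiffOn_fderiv hO hE1) hp).clm_apply
    (hasFDerivAt_snd.prodMk (hasFDerivAt_const (0 : Vec n) p))).clm_apply
    (hasFDerivAt_const a p)).sub ((hasFDerivAt_of_smooth hO (contDiffOn_fderiv hO hE) hp).clm_apply
    (hasFDerivAt_const (a, (0 : Vec n)) p))).fderiv
  have e := congrArg (fun l => l ((0 : Vec n), b)) (d1.symm.trans (h1.trans d2))
  simp at e
  rw [fderiv_fderiv_comm hO hE1 hp, fderiv_fderiv_comm hO hE hp, ← fderiv_vderiv hO hE1 hp,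
    ← fderiv_vderiv hO hE hp] at e
  have s1 := hL.cartanForm_symm₁₂ hp b (sprayVec L p) a
  simp only [cartanForm, vderiv_apply] at s1
  have s2 : fderiv ℝ (metricForm L) p (sprayDir L p) b a = fderiv ℝ (metricForm L) p (p.2, 0) b a
      - 2 * fderiv ℝ (metricForm L) p (0, sprayVec L p) b a := by
    rw [sprayDir, fderiv_split, show ((0 : Vec n), -((2 : ℝ) • sprayVec L p))
      = (-2 : ℝ) • ((0 : Vec n), sprayVec L p) by simp, map_smul]
    simp only [add_apply, smul_apply, smul_eq_mul]
    ring
  have s3 : connForm L p b = fderiv ℝ (sprayVec L) p (0, b) := vderiv_apply b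
  have s4 : fderiv ℝ (vderiv (vderiv (energy L))) p (p.2, 0) b a
    = fderiv ℝ (metricForm L) p (p.2, 0) b a := rfl
  rw [s2, s3]
  linarith

/-- `g_{ij|0} = 0`. -/
lemma fderiv_metricForm_sprayDir (hp : p ∈ D) (a b : Vec n) :
    fderiv ℝ (metricForm L) p (sprayDir L p) a b
      = metricForm L p (connForm L p a) b + metricForm L p a (connForm L p b) := by
  have h1 := hL.two_mul_metricForm_conn hp a b
  have h2 := hL.two_mul_metricForm_conn hp b a
  have h3 := hL.fderiv_metricForm_symm hp (sprayDir L p) a b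
  have h4 := hL.metricForm_symm hp a (connForm L p b)
  linarith

/-- `δ_a (∂̇_b E) = δ_b (∂̇_a E)`. -/
lemma fderiv_vderiv_energy_hlift (hp : p ∈ D) (a b : Vec n) :
    fderiv ℝ (vderiv (energy L)) p (hlift L p a) b
      = fderiv ℝ (vderiv (energy L)) p (hlift L p b) a := by
  have h1 := hL.two_mul_metricForm_conn hp a b
  have h2 := hL.two_mul_metricForm_conn hp b a
  have h3 := hL.fderiv_metricForm_symm hp (sprayDir L p) a b
  have h : ∀ c d : Vec n, fderiv ℝ (vderiv (energy L)) p (hlift L p c) d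
      = fderiv ℝ (vderiv (energy L)) p (c, 0) d - metricForm L p (connForm L p c) d := by
    intro c d
    rw [hlift_apply, fderiv_split, add_apply, show ((0 : Vec n), -connForm L p c)
      = -((0 : Vec n), connForm L p c) by simp, map_neg, neg_apply, ← sub_eq_add_neg]
    simp only [metricForm, vderiv_apply]
  rw [h, h]
  linarith

/-- `F^i_jk yʲ = G^i_k`. -/
lemma cartanFVec_self (hp : p ∈ D) (a : Vec n) :
    cartanFVec L p p.2 a = connForm L p a := by
  rw [← sub_eq_zero]
  refine hL.metricForm_nondeg hp fun c => ?_
  rw [hL.metricForm_symm hp, map_sub, sub_apply]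
  have h1 := hL.two_mul_metricForm_cartanF hp p.2 a c
  rw [hL.hlift_self hp] at h1
  have h2 := hL.fderiv_metricForm_sprayDir hp a c
  -- differentiate `g(y, d) = ∂̇_d E`
  have h3 : ∀ r d : Vec n, fderiv ℝ (metricForm L) p (hlift L p r) p.2 d
      = fderiv ℝ (vderiv (energy L)) p (hlift L p r) d + metricForm L p (connForm L p r) d := by
    intro r d
    have e := fderiv_congr_of_isOpen hL.isOpen (fun q hq => hL.metricForm_self hq d) hp
    have d1 := (((hL.hasFDerivAt_metricForm hp).clm_apply hasFDerivAt_snd).clm_apply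
      (hasFDerivAt_const d p)).fderiv
    have e := congrArg (fun l => l (hlift L p r)) (d1.symm.trans e)
    beta_reduce at e
    rw [fderiv_apply_const hL.isOpen (contDiffOn_vderiv hL.isOpen hL.energy_smooth) hp] at e
    simp at e
    rw [hlift_apply]
    linarith
  rw [h3, h3, hL.fderiv_vderiv_energy_hlift hp c a] at h1
  rw [hL.metricForm_symm hp a] at h2
  linarith

lemma fderiv_cartanForm_symm₂₃ (hp : p ∈ D) (q : Vec n × Vec n) (a b c : Vec n) :
    fderiv ℝ (cartanForm L) p q a b c = fderiv ℝ (cartanForm L) p q a c b := by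
  have h := hL.cartanForm_smooth
  have h1 : ContDiffOn ℝ ∞ (fun q => cartanForm L q a) D := h.clm_apply contDiffOn_const
  have h2 : ∀ d : Vec n, ContDiffOn ℝ ∞ (fun q => cartanForm L q a d) D := fun d =>
    h1.clm_apply contDiffOn_const
  have key : ∀ d e : Vec n, fderiv ℝ (fun q => cartanForm L q a d e) p q
      = fderiv ℝ (cartanForm L) p q a d e := fun d e => by
    rw [fderiv_apply_const hL.isOpen (h2 d) hp, fderiv_apply_const hL.isOpen h1 hp,
      fderiv_apply_const hL.isOpen h hp]
  rw [← key, ← key, fderiv_congr_of_isOpen hL.isOpen (fun q hq => hL.cartanForm_symm₂₃ hq a b c) hp]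

lemma fderiv_cartanForm_symm₁₂ (hp : p ∈ D) (q : Vec n × Vec n) (a b c : Vec n) :
    fderiv ℝ (cartanForm L) p q a b c = fderiv ℝ (cartanForm L) p q b a c := by
  have h := hL.cartanForm_smooth
  have h1 : ∀ d : Vec n, ContDiffOn ℝ ∞ (fun q => cartanForm L q d) D := fun d =>
    h.clm_apply contDiffOn_const
  have key : ∀ d e : Vec n, fderiv ℝ (fun q => cartanForm L q d e c) p q
      = fderiv ℝ (cartanForm L) p q d e c := fun d e => by
    rw [fderiv_apply_const hL.isOpen ((h1 d).clm_apply contDiffOn_const) hp,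
      fderiv_apply_const hL.isOpen (h1 d) hp, fderiv_apply_const hL.isOpen h hp]
  rw [← key, ← key, fderiv_congr_of_isOpen hL.isOpen (fun q hq => hL.cartanForm_symm₁₂ hq a b c) hp]

lemma landsberg_symm₁₂ (hp : p ∈ D) (a b c : Vec n) :
    landsberg L p a b c = landsberg L p b a c := by
  simp only [landsberg]
  rw [hL.fderiv_cartanForm_symm₁₂ hp, hL.cartanForm_symm₁₂ hp _ b, hL.cartanForm_symm₁₂ hp a,
    hL.cartanForm_symm₁₂ hp a b (connForm L p c)]
  ring

lemma landsberg_symm₂₃ (hp : p ∈ D) (a b c : Vec n) :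
    landsberg L p a b c = landsberg L p a c b := by
  simp only [landsberg]
  rw [hL.fderiv_cartanForm_symm₂₃ hp, hL.cartanForm_symm₂₃ hp _ b, hL.cartanForm_symm₂₃ hp a _ c,
    hL.cartanForm_symm₂₃ hp a b (connForm L p c)]
  ring

/-- The `y`-derivative of `g_{ij|0} = 0`, combined with `g_{ij|k} = 0`. -/
lemma metricForm_berwald_sub_cartan_add (hp : p ∈ D) (a b c : Vec n) :
    metricForm L p (vderiv (connForm L) p c a - cartanFVec L p a c) b
      + metricForm L p (vderiv (connForm L) p c b - cartanFVec L p b c) a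
      = landsberg L p c a b := by
  have hO := hL.isOpen
  have hg := hL.metricForm_smooth
  have h1 := fderiv_congr_of_isOpen hO (fun q hq => hL.fderiv_metricForm_sprayDir hq a b) hp
  have dG := hasFDerivAt_of_smooth hO hL.connForm_smooth hp
  have dg := hL.hasFDerivAt_metricForm hp
  have d1 := ((((hasFDerivAt_of_smooth hO (contDiffOn_fderiv hO hg) hp).clm_apply
    (hasFDerivAt_snd.prodMk ((hasFDerivAt_of_smooth hO hL.sprayVec_smooth hp).const_smul
      (2 : ℝ)).neg)).clm_apply (hasFDerivAt_const a p)).clm_apply (hasFDerivAt_const b p)).fderiv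
  have d2 := (((dg.clm_apply (dG.clm_apply (hasFDerivAt_const a p))).clm_apply
    (hasFDerivAt_const b p)).add ((dg.clm_apply (hasFDerivAt_const a p)).clm_apply
      (dG.clm_apply (hasFDerivAt_const b p)))).fderiv
  have e := congrArg (fun l => l ((0 : Vec n), c)) (d1.symm.trans (h1.trans d2))
  simp at e
  rw [fderiv_fderiv_comm hO hg hp, ← fderiv_vderiv hO hg hp] at e
  have m := hL.fderiv_metricForm_hlift hp a b c
  have s : fderiv ℝ (metricForm L) p (c, -((2 : ℝ) • fderiv ℝ (sprayVec L) p (0, c))) a b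
      = fderiv ℝ (metricForm L) p (hlift L p c) a b - cartanForm L p (connForm L p c) a b := by
    have : (c, -((2 : ℝ) • fderiv ℝ (sprayVec L) p (0, c)))
        = hlift L p c - ((0 : Vec n), connForm L p c) := by
      rw [hlift_apply, connForm, vderiv_apply, Prod.mk_sub_mk, two_smul]
      simp [sub_eq_add_neg]
    rw [this, map_sub, cartanForm, vderiv_apply]
    rfl
  simp only [landsberg, map_sub, sub_apply, vderiv_apply]
  rw [hL.metricForm_symm hp (fderiv ℝ (connForm L) p (0, c) b),
    hL.metricForm_symm hp (cartanFVec L p b c)]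
  have s5 : ∀ v w : Vec n, cartanForm L p c v w = fderiv ℝ (metricForm L) p (0, c) v w :=
    fun v w => by simp [cartanForm]
  have s6 : sprayDir L p = (p.2, -((2 : ℝ) • sprayVec L p)) := rfl
  have s7 : fderiv ℝ (vderiv (metricForm L)) p (sprayDir L p) c a b
    = fderiv ℝ (cartanForm L) p (sprayDir L p) c a b := rfl
  rw [s5, s5]
  simp only [← s6] at e
  linarith

/-- The Berwald and the horizontal Cartan coefficients differ by the Landsberg tensor:
`g_ir (G^r_jk - F^r_jk) = C_{ijk|0}`. -/
lemma two_mul_metricForm_berwald_sub_cartan (hp : p ∈ D) (a b c : Vec n) :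
    2 * metricForm L p (vderiv (connForm L) p a b - cartanFVec L p a b) c
      = landsberg L p a b c := by
  have hG : ∀ v w, vderiv (connForm L) p v w = vderiv (connForm L) p w v :=
    vderiv_vderiv_comm hL.isOpen hL.sprayVec_smooth hp
  have h1 := hL.metricForm_berwald_sub_cartan_add hp b c a
  have h2 := hL.metricForm_berwald_sub_cartan_add hp a c b
  have h3 := hL.metricForm_berwald_sub_cartan_add hp a b c
  have l1 := hL.landsberg_symm₁₂ hp a b c
  have l2 := hL.landsberg_symm₂₃ hp a b c
  have l3 := hL.landsberg_symm₁₂ hp a c b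
  rw [hG a c, hL.cartanFVec_symm hp c a, hL.cartanFVec_symm hp b a] at h1
  rw [hG b a, hG b c, hL.cartanFVec_symm hp c b] at h2
  linarith

end IsFinslerMetric

end SprayIdentities

/-! ### Parametrized hypersurfaces -/

section HypersurfaceCalculus

variable {m : ℕ} {U : Set (Vec m)} {X : Vec m → Vec (m + 1)} {u : Vec m}

/-- The ambient line element of a line element `(u, v)` of the hypersurface. -/
def liftElement (X : Vec m → Vec (m + 1)) (q : Vec m × Vec m) : Vec (m + 1) × Vec (m + 1) :=
  (X q.1, fderiv ℝ X q.1 q.2)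

namespace IsHypersurface

variable (hX : IsHypersurface U X)
include hX

lemma hasFDerivAt (hu : u ∈ U) : HasFDerivAt X (fderiv ℝ X u) u :=
  ((hX.smooth.contDiffAt (hX.isOpen.mem_nhds hu)).differentiableAt (by simp)).hasFDerivAt

lemma fderiv_smooth : ContDiffOn ℝ ∞ (fderiv ℝ X) U :=
  hX.smooth.fderiv_of_isOpen hX.isOpen (by simp)

lemma hasFDerivAt_fderiv (hu : u ∈ U) :
    HasFDerivAt (fderiv ℝ X) (fderiv ℝ (fderiv ℝ X) u) u :=
  ((hX.fderiv_smooth.contDiffAt (hX.isOpen.mem_nhds hu)).differentiableAt (by simp)).hasFDerivAt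

lemma hess_symm (hu : u ∈ U) (w w' : Vec m) :
    fderiv ℝ (fderiv ℝ X) u w w' = fderiv ℝ (fderiv ℝ X) u w' w :=
  ((hX.smooth.contDiffAt (hX.isOpen.mem_nhds hu)).isSymmSndFDerivAt
    (by rw [minSmoothness_of_isRCLikeNormedField]; exact WithTop.coe_le_coe.2 le_top)).eq w w'

lemma proj_eq (hu : u ∈ U) (i : Fin (m + 1)) (α : Fin m) :
    proj X i α u = fderiv ℝ X u (Pi.single α 1) i := by
  rw [proj, (hasFDerivAt_pi'.1 (hX.hasFDerivAt hu) i).fderiv]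
  rfl

lemma push_eq (hu : u ∈ U) (v : Vec m) : push X u v = fderiv ℝ X u v := by
  ext i
  rw [push, clm_eq_sum (fderiv ℝ X u) v, Finset.sum_apply]
  exact Finset.sum_congr rfl fun α _ => by rw [hX.proj_eq hu, Pi.smul_apply, smul_eq_mul, mul_comm]

lemma proj₂_eq (hu : u ∈ U) (i : Fin (m + 1)) (α β : Fin m) :
    proj₂ X i α β u = fderiv ℝ (fderiv ℝ X) u (Pi.single α 1) (Pi.single β 1) i := by
  have h1 : (proj X i β) =ᶠ[nhds u] fun u => fderiv ℝ X u (Pi.single β 1) i :=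
    Filter.eventuallyEq_of_mem (hX.isOpen.mem_nhds hu) fun q hq => hX.proj_eq hq i β
  have h2 := (hX.hasFDerivAt_fderiv hu).clm_apply (hasFDerivAt_const (Pi.single β (1 : ℝ)) u)
  rw [proj₂, h1.fderiv_eq, (hasFDerivAt_pi'.1 h2 i).fderiv]
  simp

lemma fderiv_injective (hu : u ∈ U) : Function.Injective (fderiv ℝ X u) := by
  have h := hX.rank_eq u hu
  have e : (Matrix.of fun i α => proj X i α u).mulVecLin = (fderiv ℝ X u : Vec m →ₗ[ℝ] _) := by
    ext v i
    simp [Matrix.mulVec, dotProduct, hX.proj_eq hu, Pi.single_apply]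
  rw [Matrix.rank, e] at h
  have h2 := LinearMap.finrank_range_add_finrank_ker (fderiv ℝ X u : Vec m →ₗ[ℝ] Vec (m + 1))
  rw [h, Module.finrank_fin_fun, Nat.add_eq_left, Submodule.finrank_eq_zero] at h2
  exact LinearMap.ker_eq_bot.1 h2

variable {D : Set (Vec (m + 1) × Vec (m + 1))} {q : Vec m × Vec m}

lemma mem_lineElements : q ∈ lineElements D U X ↔ q.1 ∈ U ∧ liftElement X q ∈ D := by
  refine and_congr_right fun hu => ?_
  rw [hX.push_eq hu]
  rfl

lemma liftElement_smooth : ContDiffOn ℝ ∞ (liftElement X) {q | q.1 ∈ U} := by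
  have hfst : Set.MapsTo (Prod.fst : Vec m × Vec m → Vec m) {q | q.1 ∈ U} U := fun q hq => hq
  exact (hX.smooth.comp contDiffOn_fst hfst).prodMk
    ((hX.fderiv_smooth.comp contDiffOn_fst hfst).clm_apply contDiffOn_snd)

lemma isOpen_lineElements (hD : IsOpen D) : IsOpen (lineElements D U X) := by
  have : lineElements D U X = {q | q.1 ∈ U} ∩ liftElement X ⁻¹' D := by
    ext q
    exact hX.mem_lineElements
  rw [this]
  exact hX.liftElement_smooth.continuousOn.isOpen_inter_preimage
    (hX.isOpen.preimage continuous_fst) hD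

/-- The derivative of the lift in the direction `(w, z)` is `(B w, ∂²X(w, v) + B z)`. -/
lemma hasFDerivAt_liftElement (hu : q.1 ∈ U) :
    HasFDerivAt (liftElement X) (fderiv ℝ (liftElement X) q) q ∧
    ∀ w z, fderiv ℝ (liftElement X) q (w, z)
      = (fderiv ℝ X q.1 w, fderiv ℝ (fderiv ℝ X) q.1 w q.2 + fderiv ℝ X q.1 z) := by
  have hfst : HasFDerivAt (Prod.fst : Vec m × Vec m → Vec m)
    (ContinuousLinearMap.fst ℝ _ _) q := hasFDerivAt_fst
  have h : HasFDerivAt (liftElement X) _ q := (HasFDerivAt.comp q (hX.hasFDerivAt hu) hfst).prodMk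
    ((HasFDerivAt.comp q (hX.hasFDerivAt_fderiv hu) hfst).clm_apply hasFDerivAt_snd)
  refine ⟨h.differentiableAt.hasFDerivAt, fun w z => ?_⟩
  rw [h.fderiv]
  simp [add_comm]

end IsHypersurface

end HypersurfaceCalculus

/-! ### The unit normal and its covariant derivative -/

section Normal

variable {m : ℕ} {D : Set (Vec (m + 1) × Vec (m + 1))} {L : ScalarField (m + 1)}
  {U : Set (Vec m)} {X : Vec m → Vec (m + 1)} {N : Vec m → Vec m → Vec (m + 1)}
  {q : Vec m × Vec m}

lemma exists_eq_tangent_add_normal {J : Vec m →L[ℝ] Vec (m + 1)} (hJ : Function.Injective J)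
    {l : Vec (m + 1) →L[ℝ] ℝ} (hl : ∀ w, l (J w) = 0) {ν : Vec (m + 1)} (hν : l ν = 1)
    (a : Vec (m + 1)) : ∃ w, a = J w + l a • ν := by
  let T : Vec m × ℝ →ₗ[ℝ] Vec (m + 1) :=
    (J : Vec m →ₗ[ℝ] Vec (m + 1)).coprod (LinearMap.toSpanSingleton ℝ _ ν)
  have hT : ∀ w c, T (w, c) = J w + c • ν := fun w c => by simp [T]
  have hinj : Function.Injective T := by
    refine (injective_iff_map_eq_zero T).2 fun ⟨w, c⟩ h => ?_
    rw [hT] at h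
    have hc : c = 0 := by simpa [hl, hν] using congrArg l h
    rw [hc, zero_smul, add_zero] at h
    rw [hc, (injective_iff_map_eq_zero J).1 hJ w h]
    rfl
  have hsurj := (LinearMap.injective_iff_surjective_of_finrank_eq_finrank (by simp)).1 hinj
  obtain ⟨⟨w, c⟩, h⟩ := hsurj a
  rw [hT] at h
  refine ⟨w, ?_⟩
  have hc : l a = c := by simp [← h, hl, hν]
  rw [hc, h]

/-- The second fundamental v-tensor `M_αβ` and the normal curvature vector `H_α` vanish
identically, stated without coordinates: `∂²X(w, v) + G(B w)` is tangent to the hypersurface,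
and `C(B w, B w', N) = 0`. -/
structure IsFlatAlong (L : ScalarField (m + 1)) (D : Set (Vec (m + 1) × Vec (m + 1)))
    (U : Set (Vec m)) (X : Vec m → Vec (m + 1)) (N : Vec m → Vec m → Vec (m + 1)) : Prop where
  tangent : ∀ q ∈ lineElements D U X, ∀ w, ∃ w', fderiv ℝ (fderiv ℝ X) q.1 w q.2
    + connForm L (liftElement X q) (fderiv ℝ X q.1 w) = fderiv ℝ X q.1 w'
  cartan : ∀ q ∈ lineElements D U X, ∀ w w',
    cartanForm L (liftElement X q) (fderiv ℝ X q.1 w) (fderiv ℝ X q.1 w') (N q.1 q.2) = 0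

namespace IsUnitNormal

variable (hL : IsFinslerMetric D L) (hX : IsHypersurface U X) (hN : IsUnitNormal L D U X N)
include hL hX hN

lemma metricForm_tangent (hq : q ∈ lineElements D U X) (w : Vec m) :
    metricForm L (liftElement X q) (fderiv ℝ X q.1 w) (N q.1 q.2) = 0 := by
  have hq' := hX.mem_lineElements.1 hq
  have h : ∀ α,
      metricForm L (liftElement X q) (fderiv ℝ X q.1 (Pi.single α 1)) (N q.1 q.2) = 0 := by
    intro α
    have := hN.normal q.1 q.2 hq α
    rw [hX.push_eq hq'.1] at this
    simp only [hX.proj_eq hq'.1] at this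
    rw [← hL.sum_metric hq'.2]
    exact this
  rw [clm_eq_sum (fderiv ℝ X q.1) w, map_sum, sum_apply]
  exact Finset.sum_eq_zero fun α _ => by rw [map_smul, smul_apply, h, smul_zero]

lemma metricForm_normal (hq : q ∈ lineElements D U X) :
    metricForm L (liftElement X q) (N q.1 q.2) (N q.1 q.2) = 1 := by
  have hq' := hX.mem_lineElements.1 hq
  have := hN.unit q.1 q.2 hq
  rw [hX.push_eq hq'.1] at this
  rw [← hL.sum_metric hq'.2]
  exact this

lemma exists_decomposition (hq : q ∈ lineElements D U X) (a : Vec (m + 1)) :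
    ∃ w, a = fderiv ℝ X q.1 w + metricForm L (liftElement X q) a (N q.1 q.2) • N q.1 q.2 := by
  have hq' := hX.mem_lineElements.1 hq
  obtain ⟨w, hw⟩ := exists_eq_tangent_add_normal (hX.fderiv_injective hq'.1)
    (l := metricForm L (liftElement X q) (N q.1 q.2)) (ν := N q.1 q.2)
    (fun w => by rw [hL.metricForm_symm hq'.2, hN.metricForm_tangent hL hX hq])
    (hN.metricForm_normal hL hX hq) a
  exact ⟨w, by rwa [hL.metricForm_symm hq'.2]⟩

lemma exists_tangent (hq : q ∈ lineElements D U X) {a : Vec (m + 1)}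
    (ha : metricForm L (liftElement X q) a (N q.1 q.2) = 0) : ∃ w, a = fderiv ℝ X q.1 w := by
  obtain ⟨w, hw⟩ := hN.exists_decomposition hL hX hq a
  exact ⟨w, by rwa [ha, zero_smul, add_zero] at hw⟩

lemma eq_zero_of_orthogonal (hq : q ∈ lineElements D U X) {a : Vec (m + 1)}
    (ha : metricForm L (liftElement X q) a (N q.1 q.2) = 0)
    (ha' : ∀ w, metricForm L (liftElement X q) a (fderiv ℝ X q.1 w) = 0) : a = 0 := by
  have hq' := hX.mem_lineElements.1 hq
  refine hL.metricForm_nondeg hq'.2 fun c => ?_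
  obtain ⟨w, hw⟩ := hN.exists_decomposition hL hX hq c
  rw [hL.metricForm_symm hq'.2, hw, map_add, map_smul, ha, ha', smul_zero, add_zero]

lemma hasFDerivAt (hq : q ∈ lineElements D U X) :
    HasFDerivAt (fun r : Vec m × Vec m => N r.1 r.2)
      (fderiv ℝ (fun r : Vec m × Vec m => N r.1 r.2) q) q :=
  ((hN.smooth.contDiffAt ((hX.isOpen_lineElements hL.isOpen).mem_nhds hq)).differentiableAt
    (by simp)).hasFDerivAt

/-- Tangential part of the covariant derivative of the unit normal in the direction `(w, z)`:
differentiate `g(N, B w') = 0` and use that the Cartan connection is metrical. Here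
`Y = ∂²X(w, v) + B z + G(B w)` is the covariant derivative of the supporting element. -/
lemma metricForm_covariantDeriv_tangent (hq : q ∈ lineElements D U X) (w z w' : Vec m)
    {Y : Vec (m + 1)} (hY : Y = fderiv ℝ (fderiv ℝ X) q.1 w q.2 + fderiv ℝ X q.1 z
      + connForm L (liftElement X q) (fderiv ℝ X q.1 w)) :
    metricForm L (liftElement X q) (fderiv ℝ (fun r : Vec m × Vec m => N r.1 r.2) q (w, z)
        + cartanFVec L (liftElement X q) (N q.1 q.2) (fderiv ℝ X q.1 w)
        + cartanCVec L (liftElement X q) Y (N q.1 q.2)) (fderiv ℝ X q.1 w')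
      = -(metricForm L (liftElement X q) (fderiv ℝ (fderiv ℝ X) q.1 w w'
          + cartanFVec L (liftElement X q) (fderiv ℝ X q.1 w') (fderiv ℝ X q.1 w)) (N q.1 q.2)
        + cartanForm L (liftElement X q) Y (N q.1 q.2) (fderiv ℝ X q.1 w') / 2) := by
  have hq' := hX.mem_lineElements.1 hq
  have hl := hX.hasFDerivAt_liftElement hq'.1
  have hΛ := (hX.isOpen_lineElements hL.isOpen).mem_nhds hq
  have hfst : HasFDerivAt (Prod.fst : Vec m × Vec m → Vec m)
    (ContinuousLinearMap.fst ℝ _ _) q := hasFDerivAt_fst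
  have d := ((HasFDerivAt.comp q (hL.hasFDerivAt_metricForm hq'.2) hl.1).clm_apply
    ((HasFDerivAt.comp q (hX.hasFDerivAt_fderiv hq'.1) hfst).clm_apply
      (hasFDerivAt_const w' q))).clm_apply (hN.hasFDerivAt hL hX hq)
  have e0 := (hasFDerivAt_const (𝕜 := ℝ) (0 : ℝ) q).congr_of_eventuallyEq
    (Filter.eventuallyEq_of_mem hΛ fun r hr => hN.metricForm_tangent hL hX hr w')
  have e := congrArg (fun l : Vec m × Vec m →L[ℝ] ℝ => l (w, z)) (d.unique e0)
  simp at e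
  rw [hl.2] at e
  have s : (fderiv ℝ X q.1 w, fderiv ℝ (fderiv ℝ X) q.1 w q.2 + fderiv ℝ X q.1 z)
      = hlift L (liftElement X q) (fderiv ℝ X q.1 w) + ((0 : Vec (m + 1)), Y) := by
    rw [hlift_apply, hY, Prod.mk_add_mk]
    congr 1 <;> abel
  rw [s, map_add] at e
  have c1 : fderiv ℝ (metricForm L) (liftElement X q) (0, Y) (fderiv ℝ X q.1 w') (N q.1 q.2)
      = cartanForm L (liftElement X q) Y (N q.1 q.2) (fderiv ℝ X q.1 w') := by
    rw [hL.cartanForm_symm₂₃ hq'.2, cartanForm, vderiv_apply]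
  have c2 := hL.fderiv_metricForm_hlift hq'.2 (fderiv ℝ X q.1 w') (N q.1 q.2) (fderiv ℝ X q.1 w)
  have c3 := hL.two_mul_metricForm_cartanC hq'.2 Y (N q.1 q.2) (fderiv ℝ X q.1 w')
  simp only [add_apply] at e
  simp only [map_add, add_apply]
  rw [hL.metricForm_symm hq'.2 _ (fderiv ℝ (fun r : Vec m × Vec m => N r.1 r.2) q (w, z))] at e
  rw [hL.metricForm_symm hq'.2 (fderiv ℝ X q.1 w')] at c2
  linarith

/-- The covariant derivative of the unit normal has no normal part. -/
lemma metricForm_covariantDeriv_normal (hq : q ∈ lineElements D U X) (w z : Vec m)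
    {Y : Vec (m + 1)} (hY : Y = fderiv ℝ (fderiv ℝ X) q.1 w q.2 + fderiv ℝ X q.1 z
      + connForm L (liftElement X q) (fderiv ℝ X q.1 w)) :
    metricForm L (liftElement X q) (fderiv ℝ (fun r : Vec m × Vec m => N r.1 r.2) q (w, z)
        + cartanFVec L (liftElement X q) (N q.1 q.2) (fderiv ℝ X q.1 w)
        + cartanCVec L (liftElement X q) Y (N q.1 q.2)) (N q.1 q.2) = 0 := by
  have hq' := hX.mem_lineElements.1 hq
  have hl := hX.hasFDerivAt_liftElement hq'.1
  have hΛ := (hX.isOpen_lineElements hL.isOpen).mem_nhds hq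
  have dN := hN.hasFDerivAt hL hX hq
  have d := ((HasFDerivAt.comp q (hL.hasFDerivAt_metricForm hq'.2) hl.1).clm_apply dN).clm_apply dN
  have e0 := (hasFDerivAt_const (𝕜 := ℝ) (1 : ℝ) q).congr_of_eventuallyEq
    (Filter.eventuallyEq_of_mem hΛ fun r hr => hN.metricForm_normal hL hX hr)
  have e := congrArg (fun l : Vec m × Vec m →L[ℝ] ℝ => l (w, z)) (d.unique e0)
  simp at e
  rw [hl.2] at e
  have s : (fderiv ℝ X q.1 w, fderiv ℝ (fderiv ℝ X) q.1 w q.2 + fderiv ℝ X q.1 z)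
      = hlift L (liftElement X q) (fderiv ℝ X q.1 w) + ((0 : Vec (m + 1)), Y) := by
    rw [hlift_apply, hY, Prod.mk_add_mk]
    congr 1 <;> abel
  rw [s, map_add] at e
  have c1 : fderiv ℝ (metricForm L) (liftElement X q) (0, Y) (N q.1 q.2) (N q.1 q.2)
      = cartanForm L (liftElement X q) Y (N q.1 q.2) (N q.1 q.2) := by
    rw [cartanForm, vderiv_apply]
  have c2 := hL.fderiv_metricForm_hlift hq'.2 (N q.1 q.2) (N q.1 q.2) (fderiv ℝ X q.1 w)
  have c3 := hL.two_mul_metricForm_cartanC hq'.2 Y (N q.1 q.2) (N q.1 q.2)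
  simp only [add_apply] at e
  simp only [map_add, add_apply]
  rw [hL.metricForm_symm hq'.2 (N q.1 q.2)
    (fderiv ℝ (fun r : Vec m × Vec m => N r.1 r.2) q (w, z))] at e
  rw [hL.metricForm_symm hq'.2 (N q.1 q.2)
    (cartanFVec L (liftElement X q) (N q.1 q.2) (fderiv ℝ X q.1 w))] at c2
  linarith

end IsUnitNormal

/-- If a curve of tangent vectors at a fixed point stays tangent, so does its derivative: a family
`∂²X(w, v) + T(X, B v)` of vectors that is tangent to the hypersurface for every `v` has tangent
`v`-derivatives. -/
lemma metricForm_fderiv_of_tangent (hL : IsFinslerMetric D L) (hX : IsHypersurface U X)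
    (hN : IsUnitNormal L D U X N) (hq : q ∈ lineElements D U X)
    {K : Vec m → Vec (m + 1)} {K' : Vec m →L[ℝ] Vec (m + 1)} (hK : HasFDerivAt K K' q.2)
    {T : Vec (m + 1) × Vec (m + 1) → Vec (m + 1)} (hT : ContDiffOn ℝ ∞ T D)
    (h : ∀ v, (q.1, v) ∈ lineElements D U X →
      ∃ w', K v + T (liftElement X (q.1, v)) = fderiv ℝ X q.1 w') (w : Vec m) :
    metricForm L (liftElement X q) (K' w + vderiv T (liftElement X q) (fderiv ℝ X q.1 w))
      (N q.1 q.2) = 0 := by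
  have hq' := hX.mem_lineElements.1 hq
  set l := metricForm L (liftElement X q) (N q.1 q.2) with hl
  have hpair : HasFDerivAt (fun v : Vec m => liftElement X (q.1, v))
      (ContinuousLinearMap.prod 0 (fderiv ℝ X q.1)) q.2 :=
    (hasFDerivAt_const (X q.1) q.2).prodMk (fderiv ℝ X q.1).hasFDerivAt
  have d := HasFDerivAt.comp q.2 l.hasFDerivAt
    (hK.add (HasFDerivAt.comp q.2 (hasFDerivAt_of_smooth hL.isOpen hT hq'.2) hpair))
  have hnhds : {v | (q.1, v) ∈ lineElements D U X} ∈ nhds q.2 :=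
    (Continuous.prodMk_right q.1).continuousAt.preimage_mem_nhds
      ((hX.isOpen_lineElements hL.isOpen).mem_nhds hq)
  have e0 : HasFDerivAt (l ∘ (K + T ∘ fun v => liftElement X (q.1, v))) (0 : Vec m →L[ℝ] ℝ) q.2 :=
    (hasFDerivAt_const 0 q.2).congr_of_eventuallyEq (Filter.eventuallyEq_of_mem hnhds fun v hv => by
      obtain ⟨w', hw'⟩ := h v hv
      change l (K v + T (liftElement X (q.1, v))) = 0
      rw [hw', hl, hL.metricForm_symm hq'.2, hN.metricForm_tangent hL hX hq])
  have e := congrArg (fun l : Vec m →L[ℝ] ℝ => l w) (d.unique e0)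
  rw [hL.metricForm_symm hq'.2]
  simpa using e

namespace IsFlatAlong

variable (h : IsFlatAlong L D U X N) (hL : IsFinslerMetric D L) (hX : IsHypersurface U X)
  (hN : IsUnitNormal L D U X N)
include h hL hX hN

/-- If `H_α` and `M_αβ` vanish, the Landsberg tensor vanishes on two tangents and the normal: the
unit normal is parallel along the spray, which is tangent to the hypersurface, so `M_αβ = 0` can
be differentiated along it. -/
lemma landsberg_eq_zero (hq : q ∈ lineElements D U X) (w₁ w₂ : Vec m) :
    landsberg L (liftElement X q) (fderiv ℝ X q.1 w₁) (fderiv ℝ X q.1 w₂) (N q.1 q.2) = 0 := by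
  have hq' := hX.mem_lineElements.1 hq
  have hl := hX.hasFDerivAt_liftElement hq'.1
  have hΛ := (hX.isOpen_lineElements hL.isOpen).mem_nhds hq
  have hG : connForm L (liftElement X q) (fderiv ℝ X q.1 q.2)
      = (2 : ℝ) • sprayVec L (liftElement X q) := hL.connForm_self hq'.2
  obtain ⟨w', hw'⟩ := h.tangent q hq q.2
  -- `(v, z)` is the induced spray: its lift is the ambient spray `(y, -2G)`
  set z := -w' with hz
  have hY : (0 : Vec (m + 1)) = fderiv ℝ (fderiv ℝ X) q.1 q.2 q.2 + fderiv ℝ X q.1 z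
      + connForm L (liftElement X q) (fderiv ℝ X q.1 q.2) := by
    rw [hz, map_neg, ← hw']; abel
  have hdir : fderiv ℝ (liftElement X) q (q.2, z) = sprayDir L (liftElement X q) := by
    rw [hl.2, sprayDir, ← hG]
    congr 1
    rw [← sub_eq_zero, sub_neg_eq_add]
    exact hY.symm
  have hdN : fderiv ℝ (fun r : Vec m × Vec m => N r.1 r.2) q (q.2, z)
      = -connForm L (liftElement X q) (N q.1 q.2) := by
    have hC : cartanCVec L (liftElement X q) 0 (N q.1 q.2) = 0 := by
      ext i; simp [cartanCVec]
    have hF : ∀ a, cartanFVec L (liftElement X q) a (fderiv ℝ X q.1 q.2)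
        = connForm L (liftElement X q) a := fun a => by
      rw [hL.cartanFVec_symm hq'.2]
      exact hL.cartanFVec_self hq'.2 a
    have e1 := hN.metricForm_covariantDeriv_normal hL hX hq q.2 z hY
    have e2 := fun v => hN.metricForm_covariantDeriv_tangent hL hX hq q.2 z v hY
    rw [hC, add_zero, hF] at e1
    simp only [hC, add_zero, hF, map_zero, zero_apply, zero_div] at e2
    have := hN.eq_zero_of_orthogonal hL hX hq e1 fun v => by
      obtain ⟨v', hv'⟩ := h.tangent q hq v
      rw [e2, hX.hess_symm hq'.1, hv', hN.metricForm_tangent hL hX hq, neg_zero]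
    exact eq_neg_of_add_eq_zero_left this
  have hfst : HasFDerivAt (Prod.fst : Vec m × Vec m → Vec m)
    (ContinuousLinearMap.fst ℝ _ _) q := hasFDerivAt_fst
  have dB : ∀ w, HasFDerivAt (fun r : Vec m × Vec m => fderiv ℝ X r.1 w) _ q := fun w =>
    (HasFDerivAt.comp q (hX.hasFDerivAt_fderiv hq'.1) hfst).clm_apply (hasFDerivAt_const w q)
  have d := (((HasFDerivAt.comp q (hasFDerivAt_of_smooth hL.isOpen hL.cartanForm_smooth hq'.2)
    hl.1).clm_apply (dB w₁)).clm_apply (dB w₂)).clm_apply (hN.hasFDerivAt hL hX hq)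
  have e0 := (hasFDerivAt_const (𝕜 := ℝ) (0 : ℝ) q).congr_of_eventuallyEq
    (Filter.eventuallyEq_of_mem hΛ fun r hr => h.cartan r hr w₁ w₂)
  have e := congrArg (fun l : Vec m × Vec m →L[ℝ] ℝ => l (q.2, z)) (d.unique e0)
  simp at e
  rw [hdN, hdir] at e
  obtain ⟨a₁, ha₁⟩ := h.tangent q hq w₁
  obtain ⟨a₂, ha₂⟩ := h.tangent q hq w₂
  rw [hX.hess_symm hq'.1 q.2 w₁, hX.hess_symm hq'.1 q.2 w₂, eq_sub_of_add_eq ha₁,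
    eq_sub_of_add_eq ha₂] at e
  simp only [map_sub, sub_apply, h.cartan q hq, map_neg] at e
  rw [landsberg]
  linarith

/-- If `H_α` and `M_αβ` vanish, so does the second fundamental h-tensor `H_αβ`. -/
lemma metricForm_secondFundamental (hq : q ∈ lineElements D U X) (w w' : Vec m) :
    metricForm L (liftElement X q) (fderiv ℝ (fderiv ℝ X) q.1 w w'
      + cartanFVec L (liftElement X q) (fderiv ℝ X q.1 w') (fderiv ℝ X q.1 w)) (N q.1 q.2) = 0 := by
  have hq' := hX.mem_lineElements.1 hq
  have hT : ContDiffOn ℝ ∞ (fun p => connForm L p (fderiv ℝ X q.1 w)) D :=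
    hL.connForm_smooth.clm_apply contDiffOn_const
  have e := metricForm_fderiv_of_tangent hL hX hN hq
    (fderiv ℝ (fderiv ℝ X) q.1 w).hasFDerivAt hT (fun v hv => h.tangent (q.1, v) hv w) w'
  rw [vderiv_apply, fderiv_apply_const hL.isOpen hL.connForm_smooth hq'.2, ← vderiv_apply] at e
  have e2 := hL.two_mul_metricForm_berwald_sub_cartan hq'.2 (fderiv ℝ X q.1 w')
    (fderiv ℝ X q.1 w) (N q.1 q.2)
  rw [h.landsberg_eq_zero hL hX hN hq] at e2
  simp only [map_add, add_apply, map_sub, sub_apply] at e e2 ⊢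
  linarith

end IsFlatAlong

end Normal

/-! ### The induced connection in coordinates -/

section InducedConnection

variable {m : ℕ} {D : Set (Vec (m + 1) × Vec (m + 1))} {L : ScalarField (m + 1)}
  {U : Set (Vec m)} {X : Vec m → Vec (m + 1)} {N : Vec m → Vec m → Vec (m + 1)}
  {q : Vec m × Vec m}

lemma vTensor_eq (hL : IsFinslerMetric D L) (hX : IsHypersurface U X)
    (hq : q ∈ lineElements D U X) (α β : Fin m) :
    vTensor L X N α β q.1 q.2 = 1 / 2 * cartanForm L (liftElement X q)
      (fderiv ℝ X q.1 (Pi.single α 1)) (fderiv ℝ X q.1 (Pi.single β 1)) (N q.1 q.2) := by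
  have hq' := hX.mem_lineElements.1 hq
  have hC : ∀ i j k, cartanC L i j k (X q.1) (push X q.1 q.2)
      = 1 / 2 * cartanForm L (liftElement X q) (Pi.single i 1) (Pi.single j 1)
        (Pi.single k 1) := fun i j k => by
    rw [hX.push_eq hq'.1]
    have := hL.cartanC_eq hq'.2 i j k
    rw [hL.cartanForm_symm₁₂ hq'.2, hL.cartanForm_symm₂₃ hq'.2] at this
    exact this
  rw [trilin_eq_sum, vTensor]
  simp only [hC, Finset.mul_sum, hX.proj_eq hq'.1]
  refine Finset.sum_congr rfl fun i _ => Finset.sum_congr rfl fun j _ =>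
    Finset.sum_congr rfl fun k _ => ?_
  ring

lemma secondOrder₀_eq (hL : IsFinslerMetric D L) (hX : IsHypersurface U X)
    (hq : q ∈ lineElements D U X) (i : Fin (m + 1)) (α : Fin m) :
    secondOrder₀ L X i α q.1 q.2 = (fderiv ℝ (fderiv ℝ X) q.1 (Pi.single α 1) q.2
      + connForm L (liftElement X q) (fderiv ℝ X q.1 (Pi.single α 1))) i := by
  have hq' := hX.mem_lineElements.1 hq
  rw [secondOrder₀, hX.push_eq hq'.1, Pi.add_apply]
  congr 1
  · rw [clm_eq_sum _ q.2, Finset.sum_apply]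
    refine Finset.sum_congr rfl fun β _ => ?_
    rw [hX.proj₂_eq hq'.1, hX.hess_symm hq'.1, Pi.smul_apply, smul_eq_mul, mul_comm]
  · simp only [hX.proj_eq hq'.1]
    exact hL.sum_nonlinConn hq'.2 i _

lemma secondOrder_eq (hX : IsHypersurface U X)
    (hq : q ∈ lineElements D U X) (i : Fin (m + 1)) (α β : Fin m) :
    secondOrder L X i α β q.1 q.2 = (fderiv ℝ (fderiv ℝ X) q.1 (Pi.single α 1) (Pi.single β 1)
      + cartanFVec L (liftElement X q) (fderiv ℝ X q.1 (Pi.single α 1))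
        (fderiv ℝ X q.1 (Pi.single β 1))) i := by
  have hq' := hX.mem_lineElements.1 hq
  rw [secondOrder, hX.push_eq hq'.1, Pi.add_apply, hX.proj₂_eq hq'.1]
  simp only [hX.proj_eq hq'.1]
  rfl

lemma inducedMetric_eq (hL : IsFinslerMetric D L) (hX : IsHypersurface U X)
    (hq : q ∈ lineElements D U X) (α β : Fin m) :
    inducedMetric L X q.1 q.2 α β = metricForm L (liftElement X q)
      (fderiv ℝ X q.1 (Pi.single α 1)) (fderiv ℝ X q.1 (Pi.single β 1)) := by
  have hq' := hX.mem_lineElements.1 hq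
  rw [inducedMetric, Matrix.of_apply, hX.push_eq hq'.1, ← hL.sum_metric hq'.2]
  simp only [hX.proj_eq hq'.1]
  rfl

lemma inducedMetric_mulVec (hL : IsFinslerMetric D L) (hX : IsHypersurface U X)
    (hq : q ∈ lineElements D U X) (z : Vec m) (α : Fin m) :
    (inducedMetric L X q.1 q.2).mulVec z α = metricForm L (liftElement X q)
      (fderiv ℝ X q.1 (Pi.single α 1)) (fderiv ℝ X q.1 z) := by
  rw [clm_eq_sum (fderiv ℝ X q.1) z, map_sum, Matrix.mulVec, dotProduct]
  refine Finset.sum_congr rfl fun β _ => ?_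
  rw [inducedMetric_eq hL hX hq, map_smul, smul_eq_mul, mul_comm]

lemma inducedMetric_det_ne_zero (hL : IsFinslerMetric D L) (hX : IsHypersurface U X)
    (hN : IsUnitNormal L D U X N) (hq : q ∈ lineElements D U X) :
    (inducedMetric L X q.1 q.2).det ≠ 0 := by
  have hq' := hX.mem_lineElements.1 hq
  intro hdet
  obtain ⟨z, hz, h⟩ := Matrix.exists_mulVec_eq_zero_iff.2 hdet
  refine hz ((injective_iff_map_eq_zero _).1 (hX.fderiv_injective hq'.1) z ?_)
  refine hN.eq_zero_of_orthogonal hL hX hq (hN.metricForm_tangent hL hX hq z) fun w => ?_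
  rw [hL.metricForm_symm hq'.2, clm_eq_sum (fderiv ℝ X q.1) w, map_sum, sum_apply]
  refine Finset.sum_eq_zero fun α _ => ?_
  rw [map_smul, smul_apply, ← inducedMetric_mulVec hL hX hq, h, Pi.zero_apply, smul_zero]

/-- The inverse projection factors invert the projection factors: `B^α_i B^i_β z^β = z^α`. -/
lemma sum_invProj_tangent (hL : IsFinslerMetric D L) (hX : IsHypersurface U X)
    (hN : IsUnitNormal L D U X N) (hq : q ∈ lineElements D U X) (z : Vec m) (α : Fin m) :
    ∑ i, invProj L X α i q.1 q.2 * fderiv ℝ X q.1 z i = z α := by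
  have hq' := hX.mem_lineElements.1 hq
  have h := congrFun (Matrix.mulVec_mulVec z (inducedMetric L X q.1 q.2)⁻¹
    (inducedMetric L X q.1 q.2)) α
  rw [Matrix.nonsing_inv_mul _
    (isUnit_iff_ne_zero.2 (inducedMetric_det_ne_zero hL hX hN hq)), Matrix.one_mulVec] at h
  rw [← h]
  simp only [invProj, Finset.sum_mul]
  rw [Finset.sum_comm]
  refine Finset.sum_congr rfl fun β _ => ?_
  rw [inducedMetric_mulVec hL hX hq, hL.metricForm_symm hq'.2, ← hL.sum_metric hq'.2,
    Finset.mul_sum]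
  refine Finset.sum_congr rfl fun i _ => ?_
  rw [Finset.mul_sum]
  refine Finset.sum_congr rfl fun j _ => ?_
  rw [hX.push_eq hq'.1, hX.proj_eq hq'.1]
  simp only [liftElement]
  ring

lemma sum_inducedG (hL : IsFinslerMetric D L) (hX : IsHypersurface U X)
    (hq : q ∈ lineElements D U X) (α : Fin m) (w : Vec m) :
    ∑ β, inducedG L X α β q.1 q.2 * w β = ∑ i, invProj L X α i q.1 q.2
      * (fderiv ℝ (fderiv ℝ X) q.1 w q.2
        + connForm L (liftElement X q) (fderiv ℝ X q.1 w)) i := by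
  simp only [inducedG, Finset.sum_mul]
  rw [Finset.sum_comm]
  refine Finset.sum_congr rfl fun i _ => ?_
  have e : fderiv ℝ (fderiv ℝ X) q.1 w q.2
        + connForm L (liftElement X q) (fderiv ℝ X q.1 w)
      = ((fderiv ℝ (fderiv ℝ X) q.1).flip q.2
        + (connForm L (liftElement X q)).comp (fderiv ℝ X q.1)) w := rfl
  rw [e, clm_eq_sum _ w, Finset.sum_apply, Finset.mul_sum]
  refine Finset.sum_congr rfl fun β _ => ?_
  rw [secondOrder₀_eq hL hX hq, Pi.smul_apply, smul_eq_mul]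
  simp only [add_apply, ContinuousLinearMap.flip_apply, ContinuousLinearMap.comp_apply]
  ring

lemma bilin_eq_sum_smul {F : Type*} [NormedAddCommGroup F] [NormedSpace ℝ F]
    (l : Vec m →L[ℝ] Vec m →L[ℝ] F) (a b : Vec m) :
    l a b = ∑ i, ∑ j, (a i * b j) • l (Pi.single i 1) (Pi.single j 1) := by
  rw [clm_eq_sum l a, sum_apply]
  refine Finset.sum_congr rfl fun i _ => ?_
  rw [smul_apply, clm_eq_sum _ b, Finset.smul_sum]
  exact Finset.sum_congr rfl fun j _ => by rw [smul_smul]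

lemma cartanFVec_fderiv_eq_sum {p : Vec (m + 1) × Vec (m + 1)} (J : Vec m →L[ℝ] Vec (m + 1))
    (w w' : Vec m) : cartanFVec L p (J w) (J w')
      = ∑ β, ∑ γ, (w β * w' γ) • cartanFVec L p (J (Pi.single β 1)) (J (Pi.single γ 1)) := by
  ext i
  simp only [Finset.sum_apply, Pi.smul_apply, smul_eq_mul, cartanFVec, Finset.mul_sum]
  have hJ : ∀ (z : Vec m) j, J z j = ∑ β, z β * J (Pi.single β 1) j := fun z j => by
    rw [clm_eq_sum J z, Finset.sum_apply]
    rfl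
  have hswap : ∀ f : Fin m → Fin m → Fin (m + 1) → Fin (m + 1) → ℝ,
      ∑ β, ∑ γ, ∑ j, ∑ k, f β γ j k = ∑ j, ∑ k, ∑ β, ∑ γ, f β γ j k := fun f => by
    simp_rw [← Finset.sum_product']
    exact Finset.sum_nbij' (fun a => (a.2.2.1, a.2.2.2, a.1, a.2.1))
      (fun a => (a.2.2.1, a.2.2.2, a.1, a.2.1)) (by simp) (by simp) (by simp) (by simp) (by simp)
  rw [hswap]
  refine Finset.sum_congr rfl fun j _ => Finset.sum_congr rfl fun k _ => ?_
  rw [hJ w, hJ w', mul_assoc, Finset.sum_mul_sum, Finset.mul_sum]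
  refine Finset.sum_congr rfl fun β _ => ?_
  rw [Finset.mul_sum]
  refine Finset.sum_congr rfl fun γ _ => ?_
  ring

lemma normalCurv_eq (hL : IsFinslerMetric D L) (hX : IsHypersurface U X)
    (hq : q ∈ lineElements D U X) (α : Fin m) :
    normalCurv L X N α q.1 q.2 = metricForm L (liftElement X q)
      (fderiv ℝ (fderiv ℝ X) q.1 (Pi.single α 1) q.2
        + connForm L (liftElement X q) (fderiv ℝ X q.1 (Pi.single α 1))) (N q.1 q.2) := by
  have hq' := hX.mem_lineElements.1 hq
  rw [← hL.sum_metric hq'.2, normalCurv]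
  refine Finset.sum_congr rfl fun i _ => ?_
  rw [secondOrder₀_eq hL hX hq, conormal, Finset.sum_mul]
  refine Finset.sum_congr rfl fun j _ => ?_
  rw [hX.push_eq hq'.1]
  simp only [liftElement]
  ring

lemma sum_inducedF (hX : IsHypersurface U X) (hq : q ∈ lineElements D U X)
    (hH : ∀ γ, normalCurv L X N γ q.1 q.2 = 0) (α : Fin m) (w : Vec m) :
    ∑ β, ∑ γ, inducedF L X N α β γ q.1 q.2 * w β * w γ = ∑ i, invProj L X α i q.1 q.2
      * (fderiv ℝ (fderiv ℝ X) q.1 w w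
        + cartanFVec L (liftElement X q) (fderiv ℝ X q.1 w) (fderiv ℝ X q.1 w)) i := by
  simp only [inducedF, hH, mul_zero, add_zero, Finset.sum_mul]
  rw [sum_rotate]
  refine Finset.sum_congr rfl fun i _ => ?_
  rw [bilin_eq_sum_smul (fderiv ℝ (fderiv ℝ X) q.1) w w, cartanFVec_fderiv_eq_sum]
  simp only [Pi.add_apply, Finset.sum_apply, ← Finset.sum_add_distrib, Finset.mul_sum]
  refine Finset.sum_congr rfl fun β _ => Finset.sum_congr rfl fun γ _ => ?_
  rw [secondOrder_eq hX hq]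
  simp only [Pi.add_apply, Pi.smul_apply, smul_eq_mul]
  ring

section Smoothness

variable (hL : IsFinslerMetric D L) (hX : IsHypersurface U X) (hN : IsUnitNormal L D U X N)
include hX

lemma contDiffOn_comp_push {f : ScalarField (m + 1)}
    (hf : ContDiffOn ℝ ∞ (fun p : Vec (m + 1) × Vec (m + 1) => f p.1 p.2) D) :
    ContDiffOn ℝ ∞ (fun q : Vec m × Vec m => f (X q.1) (push X q.1 q.2)) (lineElements D U X) := by
  have h : ContDiffOn ℝ ∞ _ (lineElements D U X) :=
    hf.comp (hX.liftElement_smooth.mono fun q hq => hq.1) fun q hq => (hX.mem_lineElements.1 hq).2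
  refine h.congr fun q hq => ?_
  rw [hX.push_eq hq.1]
  rfl

lemma contDiffOn_proj (i : Fin (m + 1)) (α : Fin m) :
    ContDiffOn ℝ ∞ (fun q : Vec m × Vec m => proj X i α q.1) (lineElements D U X) := by
  have h : ContDiffOn ℝ ∞ (fun q : Vec m × Vec m => fderiv ℝ X q.1 (Pi.single α 1))
      (lineElements D U X) :=
    (hX.fderiv_smooth.comp contDiffOn_fst fun q hq => hq.1).clm_apply contDiffOn_const
  exact (contDiffOn_pi.1 h i).congr fun q hq => hX.proj_eq hq.1 i α

lemma contDiffOn_proj₂ (i : Fin (m + 1)) (α β : Fin m) :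
    ContDiffOn ℝ ∞ (fun q : Vec m × Vec m => proj₂ X i α β q.1) (lineElements D U X) := by
  have h : ContDiffOn ℝ ∞ (fun q : Vec m × Vec m =>
      fderiv ℝ (fderiv ℝ X) q.1 (Pi.single α 1) (Pi.single β 1)) (lineElements D U X) :=
    (((hX.fderiv_smooth.fderiv_of_isOpen (m := ∞) hX.isOpen (by simp)).comp contDiffOn_fst
      fun q hq => hq.1).clm_apply contDiffOn_const).clm_apply contDiffOn_const
  exact (contDiffOn_pi.1 h i).congr fun q hq => hX.proj₂_eq hq.1 i α β

include hL

lemma contDiffOn_metric_push (i j : Fin (m + 1)) : ContDiffOn ℝ ∞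
    (fun q : Vec m × Vec m => metric L i j (X q.1) (push X q.1 q.2)) (lineElements D U X) :=
  contDiffOn_comp_push hX ((hL.metric_entry_smooth i j).congr fun _ hp => hL.metric_eq hp i j)

lemma contDiffOn_secondOrder₀ (i : Fin (m + 1)) (α : Fin m) :
    ContDiffOn ℝ ∞ (fun q : Vec m × Vec m => secondOrder₀ L X i α q.1 q.2)
      (lineElements D U X) := by
  refine ContDiffOn.add (ContDiffOn.sum fun β _ => (contDiffOn_proj₂ hX i β α).mul ?_)
    (ContDiffOn.sum fun j _ => ((contDiffOn_comp_push hX (hL.nonlinConn_smooth i j)).mul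
      (contDiffOn_proj hX j α)))
  exact ((contDiff_apply ℝ ℝ β).comp contDiff_snd).contDiffOn

lemma contDiffOn_secondOrder (i : Fin (m + 1)) (α β : Fin m) :
    ContDiffOn ℝ ∞ (fun q : Vec m × Vec m => secondOrder L X i α β q.1 q.2)
      (lineElements D U X) :=
  (contDiffOn_proj₂ hX i α β).add (ContDiffOn.sum fun j _ => ContDiffOn.sum fun k _ =>
    ((contDiffOn_comp_push hX (hL.cartanF_smooth i j k)).mul (contDiffOn_proj hX j α)).mul
      (contDiffOn_proj hX k β))

include hN

lemma contDiffOn_inducedMetric_inv (α β : Fin m) :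
    ContDiffOn ℝ ∞ (fun q : Vec m × Vec m => (inducedMetric L X q.1 q.2)⁻¹ α β)
      (lineElements D U X) := by
  refine contDiffOn_matrix_inv (A := fun q : Vec m × Vec m => inducedMetric L X q.1 q.2)
    (fun γ δ => ?_) (fun q hq => inducedMetric_det_ne_zero hL hX hN hq) α β
  simp only [inducedMetric, Matrix.of_apply]
  exact ContDiffOn.sum fun i _ => ContDiffOn.sum fun j _ =>
    ((contDiffOn_metric_push hL hX i j).mul (contDiffOn_proj hX i γ)).mul (contDiffOn_proj hX j δ)

lemma contDiffOn_invProj (α : Fin m) (i : Fin (m + 1)) :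
    ContDiffOn ℝ ∞ (fun q : Vec m × Vec m => invProj L X α i q.1 q.2) (lineElements D U X) :=
  ContDiffOn.sum fun β _ => ContDiffOn.sum fun j _ =>
    ((contDiffOn_inducedMetric_inv hL hX hN α β).mul (contDiffOn_metric_push hL hX i j)).mul
      (contDiffOn_proj hX j β)

lemma contDiffOn_inducedG (α β : Fin m) :
    ContDiffOn ℝ ∞ (fun q : Vec m × Vec m => inducedG L X α β q.1 q.2) (lineElements D U X) :=
  ContDiffOn.sum fun i _ => (contDiffOn_invProj hL hX hN α i).mul
    (contDiffOn_secondOrder₀ hL hX i β)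

lemma contDiffOn_inducedF (α β γ : Fin m) :
    ContDiffOn ℝ ∞ (fun q : Vec m × Vec m => inducedF L X N α β γ q.1 q.2)
      (lineElements D U X) := by
  have hNi := contDiffOn_pi.1 hN.smooth
  have hC : ∀ i j k, ContDiffOn ℝ ∞
      (fun p : Vec (m + 1) × Vec (m + 1) => cartanC L i j k p.1 p.2) D := fun i j k =>
    (contDiffOn_const.mul (((hL.cartanForm_smooth.clm_apply contDiffOn_const).clm_apply
      contDiffOn_const).clm_apply contDiffOn_const)).congr fun _ hp => hL.cartanC_eq hp i j k
  refine ContDiffOn.add (ContDiffOn.sum fun i _ => (contDiffOn_invProj hL hX hN α i).mul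
    (contDiffOn_secondOrder hL hX i β γ)) (ContDiffOn.mul (ContDiffOn.sum fun ε _ =>
      (contDiffOn_inducedMetric_inv hL hX hN α ε).mul ?_) ?_)
  · exact ContDiffOn.sum fun i _ => ContDiffOn.sum fun j _ => ContDiffOn.sum fun k _ =>
      (((contDiffOn_comp_push hX (hC i j k)).mul (contDiffOn_proj hX i ε)).mul
        (contDiffOn_proj hX j β)).mul (hNi k)
  · exact ContDiffOn.sum fun i _ => (ContDiffOn.sum fun j _ =>
      (contDiffOn_metric_push hL hX i j).mul (hNi j)).mul (contDiffOn_secondOrder₀ hL hX i γ)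

end Smoothness

end InducedConnection

/-! ### Existence of h-paths -/

section Paths

variable {n : ℕ}

/-- Existence of h-paths with prescribed initial line element and velocity. -/
lemma exists_isHPath {S : Set (Vec n × Vec n)} (hS : IsOpen S)
    {F : Fin n → Fin n → Fin n → ScalarField n} {G : Fin n → Fin n → ScalarField n}
    (hF : ∀ i j k, ContDiffOn ℝ ∞ (fun q : Vec n × Vec n => F i j k q.1 q.2) S)
    (hG : ∀ i j, ContDiffOn ℝ ∞ (fun q : Vec n × Vec n => G i j q.1 q.2) S)
    {u₀ v₀ : Vec n} (h₀ : (u₀, v₀) ∈ S) (w₀ : Vec n) :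
    ∃ ε > 0, ∃ u v : ℝ → Vec n, IsHPath S F G (-ε) ε u v ∧ u 0 = u₀ ∧ v 0 = v₀ ∧
      deriv u 0 = w₀ := by
  -- the first-order system for `((u, v), w)` with `w` the velocity of `u`
  let Ψ : (Vec n × Vec n) × Vec n → (Vec n × Vec n) × Vec n := fun r =>
    ((r.2, fun i => -∑ j, G i j r.1.1 r.1.2 * r.2 j),
      fun i => -∑ j, ∑ k, F i j k r.1.1 r.1.2 * r.2 j * r.2 k)
  have hS' : IsOpen {r : (Vec n × Vec n) × Vec n | r.1 ∈ S} := hS.preimage continuous_fst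
  have hw : ∀ j, ContDiffOn ℝ ∞ (fun r : (Vec n × Vec n) × Vec n => r.2 j) {r | r.1 ∈ S} :=
    fun j => ((contDiff_apply ℝ ℝ j).comp contDiff_snd).contDiffOn
  have hΨ : ContDiffOn ℝ ∞ Ψ {r | r.1 ∈ S} := by
    refine ContDiffOn.prodMk (ContDiffOn.prodMk contDiffOn_snd ?_) ?_
    · exact contDiffOn_pi.2 fun i => (ContDiffOn.sum fun j _ =>
        ((hG i j).comp contDiffOn_fst fun r hr => hr).mul (hw j)).neg
    · exact contDiffOn_pi.2 fun i => (ContDiffOn.sum fun j _ => ContDiffOn.sum fun k _ =>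
        (((hF i j k).comp contDiffOn_fst fun r hr => hr).mul (hw j)).mul (hw k)).neg
  have hΨ₀ : ContDiffAt ℝ 1 Ψ ((u₀, v₀), w₀) :=
    (hΨ.contDiffAt (hS'.mem_nhds h₀)).of_le (by simp)
  obtain ⟨α, hα₀, ε₁, hε₁, hα⟩ :=
    hΨ₀.exists_forall_mem_closedBall_exists_eq_forall_mem_Ioo_hasDerivAt₀ 0
  simp only [zero_sub, zero_add] at hα
  have hcont : ContinuousAt α 0 := (hα 0 ⟨by linarith, hε₁⟩).continuousAt
  obtain ⟨ε₂, hε₂, hmem⟩ := Metric.mem_nhds_iff.1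
    (hcont.preimage_mem_nhds (hS'.mem_nhds (by rw [hα₀]; exact h₀)))
  set ε := min ε₁ ε₂ with hε
  have hsub : ∀ t ∈ Set.Ioo (-ε) ε, t ∈ Set.Ioo (-ε₁) ε₁ ∧ (α t).1 ∈ S := by
    intro t ht
    have h1 := min_le_left ε₁ ε₂
    have h2 := min_le_right ε₁ ε₂
    refine ⟨⟨by linarith [ht.1], by linarith [ht.2]⟩, hmem ?_⟩
    rw [mem_ball_zero_iff, Real.norm_eq_abs, abs_lt]
    exact ⟨by linarith [ht.1], by linarith [ht.2]⟩
  have hu : ∀ t ∈ Set.Ioo (-ε) ε, HasDerivAt (fun t => (α t).1.1) (α t).2 t := fun t ht =>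
    by simpa [Ψ] using (hα t (hsub t ht).1).hasFDerivAt.fst.fst.hasDerivAt
  have hv : ∀ t ∈ Set.Ioo (-ε) ε, HasDerivAt (fun t => (α t).1.2) (Ψ (α t)).1.2 t := fun t ht =>
    by simpa [Ψ] using (hα t (hsub t ht).1).hasFDerivAt.fst.snd.hasDerivAt
  have hdu : ∀ t ∈ Set.Ioo (-ε) ε, HasDerivAt (deriv fun t => (α t).1.1) (Ψ (α t)).2 t :=
    fun t ht => ((ContinuousLinearMap.snd ℝ _ _).hasFDerivAt.comp_hasDerivAt
      t (hα t (hsub t ht).1)).congr_of_eventuallyEq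
      (Filter.eventuallyEq_of_mem (isOpen_Ioo.mem_nhds ht) fun s hs => (hu s hs).deriv)
  have hεpos : 0 < ε := lt_min hε₁ hε₂
  refine ⟨ε, hεpos, fun t => (α t).1.1, fun t => (α t).1.2,
    ⟨fun t ht => (hsub t ht).2, fun t ht => (hu t ht).differentiableAt,
      fun t ht => (hdu t ht).differentiableAt, fun t ht => (hv t ht).differentiableAt,
      fun t ht i => ?_, fun t ht i => ?_⟩, by simp [hα₀], by simp [hα₀], ?_⟩
  · rw [(hdu t ht).deriv, (hu t ht).deriv]
    exact neg_add_cancel _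
  · rw [(hv t ht).deriv, (hu t ht).deriv]
    exact neg_add_cancel _
  · rw [(hu 0 ⟨by linarith, hεpos⟩).deriv, hα₀]

end Paths

/-! ### Characterization of the hyperplanes of the second and third kind -/

section Hyperplanes

variable {m : ℕ} {D : Set (Vec (m + 1) × Vec (m + 1))} {L : ScalarField (m + 1)}
  {U : Set (Vec m)} {X : Vec m → Vec (m + 1)} {N : Vec m → Vec m → Vec (m + 1)}
  (hL : IsFinslerMetric D L) (hX : IsHypersurface U X) (hN : IsUnitNormal L D U X N)

/-- The hypothesis on `H_α` only has to be checked for the spray: `H_0 = 0` on all line elements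
implies `H_α = 0`, by differentiation in `v`. -/
lemma isFlatAlong_of_spray (hL : IsFinslerMetric D L) (hX : IsHypersurface U X)
    (hN : IsUnitNormal L D U X N)
    (h₀ : ∀ q ∈ lineElements D U X, ∃ w', fderiv ℝ (fderiv ℝ X) q.1 q.2 q.2
      + (2 : ℝ) • sprayVec L (liftElement X q) = fderiv ℝ X q.1 w')
    (hM : ∀ q ∈ lineElements D U X, ∀ w w', cartanForm L (liftElement X q) (fderiv ℝ X q.1 w)
      (fderiv ℝ X q.1 w') (N q.1 q.2) = 0) : IsFlatAlong L D U X N := by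
  refine ⟨fun q hq w => hN.exists_tangent hL hX hq ?_, hM⟩
  have hq' := hX.mem_lineElements.1 hq
  have hK := (fderiv ℝ (fderiv ℝ X) q.1).hasFDerivAt (x := q.2) |>.clm_apply (hasFDerivAt_id q.2)
  have e := metricForm_fderiv_of_tangent hL hX hN hq hK
    (hL.sprayVec_smooth.const_smul (2 : ℝ)) (fun v hv => h₀ (q.1, v) hv) w
  have hs : vderiv (fun p => (2 : ℝ) • sprayVec L p) (liftElement X q) (fderiv ℝ X q.1 w)
      = (2 : ℝ) • connForm L (liftElement X q) (fderiv ℝ X q.1 w) := by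
    have d : HasFDerivAt (fun p => (2 : ℝ) • sprayVec L p) _ (liftElement X q) :=
      (hasFDerivAt_of_smooth hL.isOpen hL.sprayVec_smooth hq'.2).const_smul (2 : ℝ)
    rw [vderiv_apply, d.fderiv, connForm, vderiv_apply]
    rfl
  rw [hs] at e
  simp [hX.hess_symm hq'.1 q.2 w] at e
  simp only [map_add, add_apply]
  linarith

/-- Derivatives along a curve on the hypersurface. -/
lemma hasDerivAt_comp_hypersurface (hX : IsHypersurface U X) {u v : ℝ → Vec m} {t : ℝ}
    (hut : u t ∈ U) {u' v' : Vec m} (hu : HasDerivAt u u' t) (hv : HasDerivAt v v' t) :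
    HasDerivAt (fun s => X (u s)) (fderiv ℝ X (u t) u') t ∧
    HasDerivAt (fun s => fderiv ℝ X (u s) (v s))
      (fderiv ℝ (fderiv ℝ X) (u t) u' (v t) + fderiv ℝ X (u t) v') t :=
  ⟨(hX.hasFDerivAt hut).comp_hasDerivAt t hu,
    ((hX.hasFDerivAt_fderiv hut).comp_hasDerivAt t hu).clm_apply hv⟩

include hL hX hN

lemma IsFlatAlong.normalCurv_eq_zero (h : IsFlatAlong L D U X N) {q : Vec m × Vec m}
    (hq : q ∈ lineElements D U X) (α : Fin m) : normalCurv L X N α q.1 q.2 = 0 := by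
  obtain ⟨w', hw'⟩ := h.tangent q hq (Pi.single α 1)
  rw [normalCurv_eq hL hX hq, hw', hN.metricForm_tangent hL hX hq]

theorem IsHyperplaneSecondKind.isFlatAlong (h : IsHyperplaneSecondKind L D U X N)
    (hM : ∀ u v, (u, v) ∈ lineElements D U X → ∀ α β, vTensor L X N α β u v = 0) :
    IsFlatAlong L D U X N := by
  have hΛ := hX.isOpen_lineElements hL.isOpen
  refine isFlatAlong_of_spray hL hX hN (fun q hq => ?_) fun q hq w w' => ?_
  · have hq' := hX.mem_lineElements.1 hq
    obtain ⟨ε, hε, u, v, hp, hu0, hv0, hw0⟩ := exists_isHPath hΛ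
      (contDiffOn_inducedF hL hX hN) (contDiffOn_inducedG hL hX hN) (u₀ := q.1) (v₀ := q.2) hq q.2
    have h0 : (0 : ℝ) ∈ Set.Ioo (-ε) ε := ⟨by linarith, hε⟩
    have hpar := (h _ _ u v hp).parallel_eq 0 h0
    have hd := hasDerivAt_comp_hypersurface hX (by rw [hu0]; exact hq.1)
      (hp.differentiable_x 0 h0).hasDerivAt (hp.differentiable_y 0 h0).hasDerivAt
    have hpush : (fun t => push X (u t) (v t)) =ᶠ[nhds 0] fun t => fderiv ℝ X (u t) (v t) :=
      Filter.eventuallyEq_of_mem (isOpen_Ioo.mem_nhds h0) fun t ht => hX.push_eq (hp.mem t ht).1 _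
    rw [hpush.deriv_eq, hd.1.deriv, hd.2.deriv, hu0, hv0, hw0, hX.push_eq hq.1] at hpar
    refine ⟨-deriv v 0, ?_⟩
    ext i
    have e := hpar i
    rw [hL.sum_nonlinConn (p := (X q.1, fderiv ℝ X q.1 q.2)) hq'.2,
      hL.connForm_self (p := (X q.1, fderiv ℝ X q.1 q.2)) hq'.2] at e
    rw [map_neg]
    simp only [Pi.add_apply, Pi.neg_apply, Pi.smul_apply, liftElement] at e ⊢
    linarith
  · have hv : ∀ α β, cartanForm L (liftElement X q) (fderiv ℝ X q.1 (Pi.single α 1))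
        (fderiv ℝ X q.1 (Pi.single β 1)) (N q.1 q.2) = 0 := fun α β => by
      have := hM q.1 q.2 hq α β
      rw [vTensor_eq hL hX hq] at this
      linarith
    rw [clm_eq_sum (fderiv ℝ X q.1) w, clm_eq_sum (fderiv ℝ X q.1) w']
    simp [hv, sum_apply]

theorem IsFlatAlong.isHyperplaneSecondKind (h : IsFlatAlong L D U X N) :
    IsHyperplaneSecondKind L D U X N := by
  intro a c u v hp
  have hU : ∀ t ∈ Set.Ioo a c, u t ∈ U := fun t ht => (hp.mem t ht).1
  have hd := fun t ht => hasDerivAt_comp_hypersurface hX (hU t ht)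
    (hp.differentiable_x t ht).hasDerivAt (hp.differentiable_y t ht).hasDerivAt
  have hpush : ∀ t ∈ Set.Ioo a c, (fun t => push X (u t) (v t)) =ᶠ[nhds t]
      fun t => fderiv ℝ X (u t) (v t) := fun t ht =>
    Filter.eventuallyEq_of_mem (isOpen_Ioo.mem_nhds ht) fun t ht => hX.push_eq (hU t ht) _
  have hvel : ∀ t ∈ Set.Ioo a c, HasDerivAt (deriv fun t => X (u t))
      (fderiv ℝ (fderiv ℝ X) (u t) (deriv u t) (deriv u t)
        + fderiv ℝ X (u t) (deriv (deriv u) t)) t := fun t ht =>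
    (hasDerivAt_comp_hypersurface hX (hU t ht) (hp.differentiable_x t ht).hasDerivAt
      (hp.differentiable_velocity t ht).hasDerivAt).2.congr_of_eventuallyEq
      (Filter.eventuallyEq_of_mem (isOpen_Ioo.mem_nhds ht) fun s hs => (hd s hs).1.deriv)
  refine ⟨fun t ht => (hp.mem t ht).2, fun t ht => (hd t ht).1.differentiableAt,
    fun t ht => (hvel t ht).differentiableAt,
    fun t ht => (hpush t ht).differentiableAt_iff.2 (hd t ht).2.differentiableAt,
    fun t ht i => ?_, fun t ht i => ?_⟩
  · have hq := hp.mem t ht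
    rw [(hvel t ht).deriv, (hd t ht).1.deriv]
    obtain ⟨z, hz⟩ := hN.exists_tangent hL hX hq
      (h.metricForm_secondFundamental hL hX hN hq (deriv u t) (deriv u t))
    have hz' : deriv (deriv u) t = -z := by
      ext α
      have e := hp.path_eq t ht α
      rw [sum_inducedF (q := (u t, v t)) hX hq (h.normalCurv_eq_zero hL hX hN hq), hz,
        sum_invProj_tangent hL hX hN hq] at e
      exact eq_neg_of_add_eq_zero_left e
    rw [hz', map_neg, ← hz, hX.push_eq (hU t ht)]
    simp only [Pi.add_apply, Pi.neg_apply, cartanFVec, liftElement]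
    ring
  · have hq := hp.mem t ht
    rw [(hpush t ht).deriv_eq, (hd t ht).1.deriv, (hd t ht).2.deriv]
    obtain ⟨z, hz⟩ := h.tangent _ hq (deriv u t)
    have hz' : deriv v t = -z := by
      ext α
      have e := hp.parallel_eq t ht α
      rw [sum_inducedG (q := (u t, v t)) hL hX hq, hz, sum_invProj_tangent hL hX hN hq] at e
      exact eq_neg_of_add_eq_zero_left e
    rw [hz', map_neg, ← hz, hX.push_eq (hU t ht)]
    rw [hL.sum_nonlinConn (p := (X (u t), fderiv ℝ X (u t) (v t))) (hX.mem_lineElements.1 hq).2]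
    simp only [Pi.add_apply, Pi.neg_apply, liftElement]
    ring

/-- The covariant derivative of the unit normal along a curve of line elements, without
coordinates. -/
lemma covariantDeriv_normal_eq {u v : ℝ → Vec m} {t : ℝ} (hq : (u t, v t) ∈ lineElements D U X)
    {u' v' : Vec m} (hu : HasDerivAt u u' t) (hv : HasDerivAt v v' t) (i : Fin (m + 1)) :
    deriv (fun s => N (u s) (v s) i) t
      + (∑ j, ∑ k, cartanF L i j k (X (u t)) (push X (u t) (v t)) * N (u t) (v t) j
          * deriv (fun s => X (u s) k) t)
      + (∑ j, ∑ k, cartanCUp L i j k (X (u t)) (push X (u t) (v t)) * N (u t) (v t) j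
          * (deriv (fun s => push X (u s) (v s) k) t
            + ∑ l, nonlinConn L k l (X (u t)) (push X (u t) (v t))
                * deriv (fun s => X (u s) l) t))
      = (fderiv ℝ (fun r : Vec m × Vec m => N r.1 r.2) (u t, v t) (u', v')
        + cartanFVec L (liftElement X (u t, v t)) (N (u t) (v t)) (fderiv ℝ X (u t) u')
        + cartanCVec L (liftElement X (u t, v t)) (fderiv ℝ (fderiv ℝ X) (u t) u' (v t)
          + fderiv ℝ X (u t) v' + connForm L (liftElement X (u t, v t)) (fderiv ℝ X (u t) u'))
          (N (u t) (v t))) i := by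
  have hq' := hX.mem_lineElements.1 hq
  have hd := hasDerivAt_comp_hypersurface hX hq.1 hu hv
  have hC : ∀ a b, cartanCVec L (liftElement X (u t, v t)) a b
      = cartanCVec L (liftElement X (u t, v t)) b a := fun a b => by
    rw [← sub_eq_zero]
    refine hL.metricForm_nondeg hq'.2 fun c => ?_
    have h1 := hL.two_mul_metricForm_cartanC hq'.2 a b c
    have h2 := hL.two_mul_metricForm_cartanC hq'.2 b a c
    have h3 := hL.cartanForm_symm₁₂ hq'.2 a b c
    rw [hL.metricForm_symm hq'.2, map_sub, sub_apply]
    linarith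
  have hpush : (fun s => push X (u s) (v s)) =ᶠ[nhds t] fun s => fderiv ℝ X (u s) (v s) :=
    Filter.eventuallyEq_of_mem
      (hu.continuousAt.preimage_mem_nhds (hX.isOpen.mem_nhds hq.1)) fun s hs => hX.push_eq hs _
  have e1 : deriv (fun s => N (u s) (v s) i) t
      = fderiv ℝ (fun r : Vec m × Vec m => N r.1 r.2) (u t, v t) (u', v') i :=
    (hasDerivAt_pi.1 (HasFDerivAt.comp_hasDerivAt (f := fun s => (u s, v s)) t
      (hN.hasFDerivAt hL hX hq) (hu.prodMk hv)) i).deriv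
  have e2 : ∀ k, deriv (fun s => X (u s) k) t = fderiv ℝ X (u t) u' k := fun k =>
    (hasDerivAt_pi.1 hd.1 k).deriv
  have e3 : ∀ k, deriv (fun s => push X (u s) (v s) k) t
      = (fderiv ℝ (fderiv ℝ X) (u t) u' (v t) + fderiv ℝ X (u t) v') k := fun k =>
    (hasDerivAt_pi.1 (hd.2.congr_of_eventuallyEq hpush) k).deriv
  rw [e1, hC]
  simp only [e2, e3, hX.push_eq hq.1]
  have e4 : ∀ k, ∑ l, nonlinConn L k l (X (u t)) (fderiv ℝ X (u t) (v t)) * fderiv ℝ X (u t) u' l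
      = connForm L (liftElement X (u t, v t)) (fderiv ℝ X (u t) u') k := fun k =>
    hL.sum_nonlinConn hq'.2 k _
  simp only [e4]
  rfl

theorem IsHyperplaneThirdKind.isFlatAlong (h : IsHyperplaneThirdKind L D U X N) :
    IsFlatAlong L D U X N := by
  have hΛ := hX.isOpen_lineElements hL.isOpen
  -- test the definition on the curves `t ↦ (u + t w, v + t z)`
  have key : ∀ q ∈ lineElements D U X, ∀ w z w' : Vec m, ∀ Y,
      Y = fderiv ℝ (fderiv ℝ X) q.1 w q.2 + fderiv ℝ X q.1 z
        + connForm L (liftElement X q) (fderiv ℝ X q.1 w) →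
      metricForm L (liftElement X q) (fderiv ℝ (fderiv ℝ X) q.1 w w'
          + cartanFVec L (liftElement X q) (fderiv ℝ X q.1 w') (fderiv ℝ X q.1 w)) (N q.1 q.2)
        + cartanForm L (liftElement X q) Y (N q.1 q.2) (fderiv ℝ X q.1 w') / 2 = 0 := by
    intro q hq w z w' Y hY
    have hu : ∀ t, HasDerivAt (fun t : ℝ => q.1 + t • w) w t := fun t => by
      simpa using ((hasDerivAt_id t).smul_const w).const_add q.1
    have hv : ∀ t, HasDerivAt (fun t : ℝ => q.2 + t • z) z t := fun t => by
      simpa using ((hasDerivAt_id t).smul_const z).const_add q.2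
    have hmem : (fun t : ℝ => (q.1 + t • w, q.2 + t • z)) ⁻¹' lineElements D U X ∈ nhds 0 :=
      ((hu 0).prodMk (hv 0)).continuousAt.preimage_mem_nhds
        (by simpa using hΛ.mem_nhds hq)
    obtain ⟨ε, hε, hball⟩ := Metric.mem_nhds_iff.1 hmem
    have h0 := h (-ε) ε (fun t => q.1 + t • w) (fun t => q.2 + t • z) (fun t ht => ⟨hball (by
      rw [mem_ball_zero_iff, Real.norm_eq_abs, abs_lt]; exact ht), (hu t).differentiableAt,
      (hv t).differentiableAt⟩) 0 ⟨by linarith, hε⟩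
    have hA : fderiv ℝ (fun r : Vec m × Vec m => N r.1 r.2) q (w, z)
        + cartanFVec L (liftElement X q) (N q.1 q.2) (fderiv ℝ X q.1 w)
        + cartanCVec L (liftElement X q) Y (N q.1 q.2) = 0 := by
      ext i
      have := (covariantDeriv_normal_eq hL hX hN (u := fun t => q.1 + t • w)
        (v := fun t => q.2 + t • z) (t := 0) (by simpa using hq) (hu 0) (hv 0) i).symm.trans (h0 i)
      simp only [zero_smul, add_zero] at this
      rw [hY]
      exact this
    have e := hN.metricForm_covariantDeriv_tangent hL hX hq w z w' hY
    rw [hA, map_zero, zero_apply] at e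
    linarith
  refine ⟨fun q hq w => hN.exists_tangent hL hX hq ?_, fun q hq w w' => ?_⟩
  · have hq' := hX.mem_lineElements.1 hq
    have e := key q hq w 0 q.2 _ rfl
    have hF : cartanFVec L (liftElement X q) (fderiv ℝ X q.1 q.2) (fderiv ℝ X q.1 w)
        = connForm L (liftElement X q) (fderiv ℝ X q.1 w) := hL.cartanFVec_self hq'.2 _
    have hC : cartanForm L (liftElement X q) (fderiv ℝ X q.1 q.2) = 0 := hL.cartanForm_self hq'.2
    rw [hF, hL.cartanForm_symm₂₃ hq'.2, hL.cartanForm_symm₁₂ hq'.2, hC] at e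
    simpa using e
  · have hq' := hX.mem_lineElements.1 hq
    have e := key q hq 0 w w' (fderiv ℝ X q.1 w) (by simp)
    have hF : cartanFVec L (liftElement X q) (fderiv ℝ X q.1 w') 0 = 0 := by
      ext i; simp [cartanFVec]
    rw [hL.cartanForm_symm₂₃ hq'.2] at e
    simpa [hF] using e

theorem IsFlatAlong.isHyperplaneThirdKind (h : IsFlatAlong L D U X N) :
    IsHyperplaneThirdKind L D U X N := by
  intro a c u v huv t ht i
  obtain ⟨hq, hu, hv⟩ := huv t ht
  rw [covariantDeriv_normal_eq hL hX hN hq hu.hasDerivAt hv.hasDerivAt]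
  refine congrFun (hN.eq_zero_of_orthogonal hL hX hq
    (hN.metricForm_covariantDeriv_normal hL hX hq _ _ rfl) fun w' => ?_) i
  obtain ⟨z, hz⟩ := h.tangent _ hq (deriv u t)
  have hY : fderiv ℝ (fderiv ℝ X) (u t) (deriv u t) (v t) + fderiv ℝ X (u t) (deriv v t)
      + connForm L (liftElement X (u t, v t)) (fderiv ℝ X (u t) (deriv u t))
      = fderiv ℝ X (u t) (z + deriv v t) := by
    rw [map_add, ← hz]; abel
  rw [hN.metricForm_covariantDeriv_tangent hL hX hq _ _ w' rfl,
    h.metricForm_secondFundamental hL hX hN hq, hY,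
    hL.cartanForm_symm₂₃ (hX.mem_lineElements.1 hq).2, h.cartan _ hq]
  simp

end Hyperplanes

/-! ### Transversally flat and stationary functions -/

section Transversal

variable {n : ℕ} {D : Set (Vec n × Vec n)} {f g : Vec n × Vec n → ℝ} {p : Vec n × Vec n}

/-- The derivative of a scalar in a fixed vertical direction `c`. -/
def vdir (c : Vec n) (f : Vec n × Vec n → ℝ) (p : Vec n × Vec n) : ℝ := fderiv ℝ f p (0, c)

lemma vdir_smooth (hD : IsOpen D) (hf : ContDiffOn ℝ ∞ f D) (c : Vec n) :
    ContDiffOn ℝ ∞ (vdir c f) D :=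
  (contDiffOn_fderiv hD hf).clm_apply contDiffOn_const

lemma vdir_congr (hD : IsOpen D) (h : ∀ q ∈ D, f q = g q) (c : Vec n) :
    ∀ q ∈ D, vdir c f q = vdir c g q := fun _ hq => by
  rw [vdir, vdir, fderiv_congr_of_isOpen hD h hq]

lemma vdir_add (hD : IsOpen D) (hf : ContDiffOn ℝ ∞ f D) (hg : ContDiffOn ℝ ∞ g D)
    (c : Vec n) : ∀ q ∈ D, vdir c (f + g) q = vdir c f q + vdir c g q := fun q hq => by
  simp only [vdir]
  rw [((hasFDerivAt_of_smooth hD hf hq).add (hasFDerivAt_of_smooth hD hg hq)).fderiv]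
  rfl

lemma vdir_mul (hD : IsOpen D) (hf : ContDiffOn ℝ ∞ f D) (hg : ContDiffOn ℝ ∞ g D)
    (c : Vec n) : ∀ q ∈ D, vdir c (f * g) q = f q * vdir c g q + vdir c f q * g q :=
  fun q hq => by
  simp only [vdir]
  rw [((hasFDerivAt_of_smooth hD hf hq).mul (hasFDerivAt_of_smooth hD hg hq)).fderiv]
  simp [mul_comm]

lemma contDiffOn_mul (hf : ContDiffOn ℝ ∞ f D) (hg : ContDiffOn ℝ ∞ g D) :
    ContDiffOn ℝ ∞ (f * g) D := hf.mul hg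

lemma vdir_mul₂ (hD : IsOpen D) (hf : ContDiffOn ℝ ∞ f D) (hg : ContDiffOn ℝ ∞ g D)
    (c d : Vec n) : ∀ q ∈ D, vdir d (vdir c (f * g)) q = f q * vdir d (vdir c g) q
      + vdir d f q * vdir c g q + vdir c f q * vdir d g q + vdir d (vdir c f) q * g q :=
  fun q hq => by
  have hfc := vdir_smooth hD hf c
  have hgc := vdir_smooth hD hg c
  rw [vdir_congr hD (g := f * vdir c g + vdir c f * g) (vdir_mul hD hf hg c) d q hq,
    vdir_add hD (contDiffOn_mul hf hgc) (contDiffOn_mul hfc hg) d q hq, vdir_mul hD hf hgc d q hq,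
    vdir_mul hD hfc hg d q hq]
  ring

lemma vdir_mul₃ (hD : IsOpen D) (hf : ContDiffOn ℝ ∞ f D) (hg : ContDiffOn ℝ ∞ g D)
    (c d e : Vec n) : ∀ q ∈ D, vdir e (vdir d (vdir c (f * g))) q
      = f q * vdir e (vdir d (vdir c g)) q + vdir e f q * vdir d (vdir c g) q
      + vdir d f q * vdir e (vdir c g) q + vdir e (vdir d f) q * vdir c g q
      + vdir c f q * vdir e (vdir d g) q + vdir e (vdir c f) q * vdir d g q
      + vdir d (vdir c f) q * vdir e g q + vdir e (vdir d (vdir c f)) q * g q :=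
  fun q hq => by
  have hfc := vdir_smooth hD hf c
  have hgc := vdir_smooth hD hg c
  have hc : ∀ q ∈ D, vdir d (vdir c (f * g)) q
      = (vdir d (f * vdir c g) + vdir d (vdir c f * g)) q := fun q hq => by
    rw [vdir_congr hD (g := f * vdir c g + vdir c f * g) (vdir_mul hD hf hg c) d q hq,
      vdir_add hD (contDiffOn_mul hf hgc) (contDiffOn_mul hfc hg) d q hq]
    rfl
  rw [vdir_congr hD hc e q hq, vdir_add hD (vdir_smooth hD (contDiffOn_mul hf hgc) d)
    (vdir_smooth hD (contDiffOn_mul hfc hg) d) e q hq, vdir_mul₂ hD hf hgc d e q hq,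
    vdir_mul₂ hD hfc hg d e q hq]
  ring

lemma vderiv_vderiv_eq_vdir (hD : IsOpen D) (hf : ContDiffOn ℝ ∞ f D) (hp : p ∈ D)
    (c d : Vec n) : vderiv (vderiv f) p d c = vdir d (vdir c f) p := by
  have h : ∀ q ∈ D, vdir c f q = vderiv f q c := fun q _ => (vderiv_apply c).symm
  rw [vdir_congr hD h d p hp, vdir, fderiv_apply_const hD (contDiffOn_vderiv hD hf) hp,
    vderiv_apply]

lemma vderiv_vderiv_vderiv_eq_vdir (hD : IsOpen D) (hf : ContDiffOn ℝ ∞ f D) (hp : p ∈ D)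
    (c d e : Vec n) :
    vderiv (vderiv (vderiv f)) p e d c = vdir e (vdir d (vdir c f)) p := by
  have h : ∀ q ∈ D, vdir d (vdir c f) q = vderiv (vderiv f) q d c := fun q hq =>
    (vderiv_vderiv_eq_vdir hD hf hq c d).symm
  have h2 := contDiffOn_vderiv hD (contDiffOn_vderiv hD hf)
  rw [vdir_congr hD h e p hp, vdir,
    fderiv_apply_const hD (h2.clm_apply contDiffOn_const) hp, fderiv_apply_const hD h2 hp,
    vderiv_apply]

/-- The `y`-derivatives of `f` up to order three vanish at `p` as soon as one slot is the
transversal vector `ν` and the others are in `T`. -/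
structure IsTransversallyFlat (f : Vec n × Vec n → ℝ) (p : Vec n × Vec n) (T : Set (Vec n))
    (ν : Vec n) : Prop where
  first : vdir ν f p = 0
  second : ∀ a ∈ T, vdir a (vdir ν f) p = 0
  third : ∀ a ∈ T, ∀ b ∈ T, vdir b (vdir a (vdir ν f)) p = 0

/-- At `p`, with respect to the vector `ν`, the function `f` satisfies the Euler–Lagrange
equation `r(∂̇_ν f) = ∂_ν f`, and `∂̇_ν f = 0`. Here `r` plays the role of the spray. -/
structure IsStationary (f : Vec n × Vec n → ℝ) (p r : Vec n × Vec n) (ν : Vec n) : Prop where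
  first : vdir ν f p = 0
  second : fderiv ℝ (vdir ν f) p r = fderiv ℝ f p (ν, 0)

variable {T : Set (Vec n)} {ν : Vec n} {r : Vec n × Vec n}

lemma IsTransversallyFlat.congr (hD : IsOpen D) (h : ∀ q ∈ D, f q = g q) (hp : p ∈ D)
    (hf : IsTransversallyFlat f p T ν) : IsTransversallyFlat g p T ν := by
  have h1 := vdir_congr hD h ν
  refine ⟨h1 p hp ▸ hf.first, fun a ha => ?_, fun a ha b hb => ?_⟩
  · rw [← vdir_congr hD h1 a p hp, hf.second a ha]
  · rw [← vdir_congr hD (vdir_congr hD h1 a) b p hp, hf.third a ha b hb]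

lemma IsTransversallyFlat.mul (hD : IsOpen D) (hf' : ContDiffOn ℝ ∞ f D)
    (hg' : ContDiffOn ℝ ∞ g D) (hp : p ∈ D) (hf : IsTransversallyFlat f p T ν)
    (hg : IsTransversallyFlat g p T ν) : IsTransversallyFlat (f * g) p T ν := by
  refine ⟨?_, fun a ha => ?_, fun a ha b hb => ?_⟩
  · rw [vdir_mul hD hf' hg' _ p hp, hf.first, hg.first]; ring
  · rw [vdir_mul₂ hD hf' hg' _ _ p hp, hf.first, hg.first, hf.second a ha, hg.second a ha]; ring
  · rw [vdir_mul₃ hD hf' hg' _ _ _ p hp, hf.first, hg.first, hf.second a ha, hg.second a ha,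
      hf.second b hb, hg.second b hb, hf.third a ha b hb, hg.third a ha b hb]; ring

lemma IsTransversallyFlat.of_mul (hD : IsOpen D) (hf' : ContDiffOn ℝ ∞ f D)
    (hg' : ContDiffOn ℝ ∞ g D) (hp : p ∈ D) (hg : IsTransversallyFlat g p T ν) (h0 : g p ≠ 0)
    (hfg : IsTransversallyFlat (f * g) p T ν) : IsTransversallyFlat f p T ν := by
  have h1 : vdir ν f p = 0 := by
    have e := hfg.first
    rw [vdir_mul hD hf' hg' _ p hp, hg.first] at e
    simpa [h0] using e
  have h2 : ∀ a ∈ T, vdir a (vdir ν f) p = 0 := fun a ha => by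
    have e := hfg.second a ha
    rw [vdir_mul₂ hD hf' hg' _ _ p hp, hg.first, hg.second a ha, h1] at e
    simpa [h0] using e
  refine ⟨h1, h2, fun a ha b hb => ?_⟩
  have e := hfg.third a ha b hb
  rw [vdir_mul₃ hD hf' hg' _ _ _ p hp, hg.first, hg.second a ha, hg.second b hb,
    hg.third a ha b hb, h1, h2 a ha, h2 b hb] at e
  simpa [h0] using e

lemma IsStationary.congr (hD : IsOpen D) (h : ∀ q ∈ D, f q = g q) (hp : p ∈ D)
    (hf : IsStationary f p r ν) : IsStationary g p r ν := by
  have h1 := vdir_congr hD h ν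
  refine ⟨h1 p hp ▸ hf.first, ?_⟩
  rw [← fderiv_congr_of_isOpen hD h1 hp, ← fderiv_congr_of_isOpen hD h hp, hf.second]

lemma fderiv_mul_apply (hD : IsOpen D) (hf : ContDiffOn ℝ ∞ f D)
    (hg : ContDiffOn ℝ ∞ g D) (hp : p ∈ D) (r : Vec n × Vec n) :
    fderiv ℝ (f * g) p r = f p * fderiv ℝ g p r + fderiv ℝ f p r * g p := by
  rw [((hasFDerivAt_of_smooth hD hf hp).mul (hasFDerivAt_of_smooth hD hg hp)).fderiv]
  simp [mul_comm]

lemma fderiv_vdir_mul (hD : IsOpen D) (hf : ContDiffOn ℝ ∞ f D)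
    (hg : ContDiffOn ℝ ∞ g D) (hp : p ∈ D) (r : Vec n × Vec n) (c : Vec n) :
    fderiv ℝ (vdir c (f * g)) p r = f p * fderiv ℝ (vdir c g) p r
      + fderiv ℝ f p r * vdir c g p + vdir c f p * fderiv ℝ g p r
      + fderiv ℝ (vdir c f) p r * g p := by
  have hfc := vdir_smooth hD hf c
  have hgc := vdir_smooth hD hg c
  rw [fderiv_congr_of_isOpen hD (g := f * vdir c g + vdir c f * g) (vdir_mul hD hf hg c) hp,
    fderiv_add (hasFDerivAt_of_smooth hD (contDiffOn_mul hf hgc) hp).differentiableAt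
      (hasFDerivAt_of_smooth hD (contDiffOn_mul hfc hg) hp).differentiableAt, add_apply,
    fderiv_mul_apply hD hf hgc hp, fderiv_mul_apply hD hfc hg hp]
  ring

lemma IsStationary.mul (hD : IsOpen D) (hf' : ContDiffOn ℝ ∞ f D)
    (hg' : ContDiffOn ℝ ∞ g D) (hp : p ∈ D) (hf : IsStationary f p r ν)
    (hg : IsStationary g p r ν) : IsStationary (f * g) p r ν := by
  refine ⟨?_, ?_⟩
  · rw [vdir_mul hD hf' hg' _ p hp, hf.first, hg.first]; ring
  · rw [fderiv_vdir_mul hD hf' hg' hp, fderiv_mul_apply hD hf' hg' hp, hf.first, hg.first,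
      hf.second, hg.second]; ring

lemma IsStationary.of_mul (hD : IsOpen D) (hf' : ContDiffOn ℝ ∞ f D)
    (hg' : ContDiffOn ℝ ∞ g D) (hp : p ∈ D) (hg : IsStationary g p r ν) (h0 : g p ≠ 0)
    (hfg : IsStationary (f * g) p r ν) : IsStationary f p r ν := by
  have h1 : vdir ν f p = 0 := by
    have e := hfg.first
    rw [vdir_mul hD hf' hg' _ p hp, hg.first] at e
    simpa [h0] using e
  refine ⟨h1, ?_⟩
  have e := hfg.second
  rw [fderiv_vdir_mul hD hf' hg' hp, fderiv_mul_apply hD hf' hg' hp, hg.first, hg.second, h1] at e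
  refine mul_right_cancel₀ h0 ?_
  linarith

/-- The geodesic spray satisfies the Euler–Lagrange equation of the energy. -/
lemma IsFinslerMetric.fderiv_vdir_energy_sprayDir {L : ScalarField n} (hL : IsFinslerMetric D L)
    (hp : p ∈ D) (a : Vec n) :
    fderiv ℝ (vdir a (energy L)) p (sprayDir L p) = fderiv ℝ (energy L) p (a, 0) := by
  have hv := contDiffOn_vderiv hL.isOpen hL.energy_smooth
  have h1 : ∀ q ∈ D, vdir a (energy L) q = vderiv (energy L) q a := fun q _ =>
    (vderiv_apply a).symm
  have e := hL.metricForm_spray hp a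
  rw [fderiv_congr_of_isOpen hL.isOpen h1 hp, fderiv_apply_const hL.isOpen hv hp, sprayDir,
    fderiv_split, add_apply, show ((0 : Vec n), -((2 : ℝ) • sprayVec L p))
      = (-2 : ℝ) • ((0 : Vec n), sprayVec L p) by simp, map_smul, smul_apply, ← vderiv_apply]
  change 2 * vderiv (vderiv (energy L)) p (sprayVec L p) a = _ at e
  rw [smul_eq_mul]
  linarith

end Transversal

/-! ### The function `β = b_i yⁱ` of an h-vector -/

section HVector

variable {n : ℕ} {D : Set (Vec n × Vec n)} {L : ScalarField n} {b : Vec n → Vec n → Vec n}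
  {p : Vec n × Vec n}

/-- The function `β = b_i yⁱ`. -/
def pairing (b : Vec n → Vec n → Vec n) (p : Vec n × Vec n) : ℝ := ∑ i, b p.1 p.2 i * p.2 i

namespace IsHVector

variable (hL : IsFinslerMetric D L) (hb : IsHVector D L b)
include hb

lemma component_smooth (i : Fin n) :
    ContDiffOn ℝ ∞ (fun p : Vec n × Vec n => b p.1 p.2 i) D :=
  contDiffOn_pi.1 hb.1 i

lemma pairing_smooth : ContDiffOn ℝ ∞ (pairing b) D :=
  ContDiffOn.sum fun i _ => (hb.component_smooth i).mul
    ((contDiff_apply ℝ ℝ i).comp contDiff_snd).contDiffOn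

include hL

lemma fderiv_component (hp : p ∈ D) (i j : Fin n) :
    fderiv ℝ (fun p : Vec n × Vec n => b p.1 p.2 i) p (0, Pi.single j 1)
      = ∑ r, cartanCUp L r i j p.1 p.2 * b p.1 p.2 r := by
  have h := hb.2.1 p.1 p.2 hp i j
  rw [vCov, sub_eq_zero, dy_eq hL.isOpen (hb.component_smooth i) (fun q _ => rfl) hp] at h
  exact h

/-- `∂̇_i β = b_i`, since `C^r_ij yʲ = 0`. -/
lemma vderiv_pairing (hp : p ∈ D) (a : Vec n) :
    vderiv (pairing b) p a = ∑ i, b p.1 p.2 i * a i := by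
  have hs : ∀ i : Fin n, HasFDerivAt (fun p : Vec n × Vec n => p.2 i)
      ((ContinuousLinearMap.proj i).comp (ContinuousLinearMap.snd ℝ (Vec n) (Vec n))) p := fun i =>
    ((ContinuousLinearMap.proj i).comp (ContinuousLinearMap.snd ℝ (Vec n) (Vec n))).hasFDerivAt
  have d := HasFDerivAt.fun_sum (u := Finset.univ) fun i _ =>
    (hasFDerivAt_of_smooth hL.isOpen (hb.component_smooth i) hp).mul (hs i)
  have hd : ∀ i, fderiv ℝ (fun p : Vec n × Vec n => b p.1 p.2 i) p (0, a)
      = ∑ j, a j * ∑ r, cartanCUp L r i j p.1 p.2 * b p.1 p.2 r := fun i => by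
    rw [← vderiv_apply, clm_eq_sum _ a]
    exact Finset.sum_congr rfl fun j _ => by rw [vderiv_apply, hb.fderiv_component hL hp]; rfl
  have hC : cartanCVec L p p.2 a = 0 := by
    refine hL.metricForm_nondeg hp fun c => ?_
    have h := hL.two_mul_metricForm_cartanC hp p.2 a c
    rw [hL.cartanForm_self hp] at h
    rw [hL.metricForm_symm hp]
    simpa using h
  have hzero : ∑ i, p.2 i * ∑ j, a j * ∑ r, cartanCUp L r i j p.1 p.2 * b p.1 p.2 r = 0 := by
    have : ∑ r, b p.1 p.2 r * cartanCVec L p p.2 a r = 0 := by simp [hC]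
    rw [← this]
    simp only [cartanCVec, Finset.mul_sum]
    rw [sum_rotate]
    refine Finset.sum_congr rfl fun r _ => Finset.sum_congr rfl fun i _ =>
      Finset.sum_congr rfl fun j _ => ?_
    ring
  have e : fderiv ℝ (pairing b) p = _ := d.fderiv
  rw [vderiv_apply, e]
  simp only [sum_apply, add_apply, smul_apply, ContinuousLinearMap.comp_apply,
    ContinuousLinearMap.coe_snd', ContinuousLinearMap.proj_apply, smul_eq_mul, hd,
    Finset.sum_add_distrib, hzero, add_zero]

lemma pairing_eq (hp : p ∈ D) : vderiv (pairing b) p p.2 = pairing b p :=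
  hb.vderiv_pairing hL hp p.2

lemma vderiv_pairing_single (hp : p ∈ D) (i : Fin n) :
    vderiv (pairing b) p (Pi.single i 1) = b p.1 p.2 i := by
  rw [hb.vderiv_pairing hL hp]
  simp [Pi.single_apply]

/-- The `y`-Hessian of `β` is proportional to the angular metric, in the form
`L² h_ij = 2 E g_ij - ∂̇_i E ∂̇_j E`. -/
lemma exists_vderiv_vderiv_pairing (hp : p ∈ D) : ∃ σ : ℝ, ∀ a c,
    vderiv (vderiv (pairing b)) p a c = σ * (2 * energy L p * metricForm L p a c
      - vderiv (energy L) p a * vderiv (energy L) p c) := by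
  have hO := hL.isOpen
  have hs := hL.smooth
  have hLp := hL.pos p.1 p.2 hp
  obtain ⟨ρ, hρ⟩ := hb.2.2
  -- the `y`-derivatives of `E = L²/2` in terms of those of `L`
  have hL1 : ∀ c, ∀ q ∈ D, vderiv (energy L) q c
      = L q.1 q.2 * vderiv (fun q : Vec n × Vec n => L q.1 q.2) q c := fun c q hq => by
    have d := ((hasFDerivAt_of_smooth hO hs hq).pow 2).mul_const (2⁻¹ : ℝ)
    have e : fderiv ℝ (energy L) q = _ := d.fderiv
    rw [vderiv_apply, vderiv_apply, e]
    simp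
    ring
  have hL2 : ∀ a c, metricForm L p a c
      = L p.1 p.2 * vderiv (vderiv fun q : Vec n × Vec n => L q.1 q.2) p a c
        + vderiv (fun q : Vec n × Vec n => L q.1 q.2) p a
          * vderiv (fun q : Vec n × Vec n => L q.1 q.2) p c := fun a c => by
    have hv := contDiffOn_vderiv hO hs
    have d := ((hasFDerivAt_of_smooth hO hs hp).mul ((hasFDerivAt_of_smooth hO hv hp).clm_apply
      (hasFDerivAt_const c p))).fderiv
    have e := (fderiv_congr_of_isOpen hO (hL1 c) hp).trans d
    rw [metricForm, vderiv_apply, ← fderiv_apply_const hO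
      (contDiffOn_vderiv hO hL.energy_smooth) hp, e]
    simp
    ring
  have hang : ∀ i j, angular L i j p.1 p.2
      = L p.1 p.2 * vderiv (vderiv fun q : Vec n × Vec n => L q.1 q.2) p
        (Pi.single j 1) (Pi.single i 1) := fun i j => by
    have hv := contDiffOn_vderiv hO hs
    have h1 : ∀ q ∈ D, dy L j q.1 q.2
        = vderiv (fun q : Vec n × Vec n => L q.1 q.2) q (Pi.single j 1) := fun q hq => by
      rw [dy_eq hO hs (fun q _ => rfl) hq, vderiv_apply]
    rw [angular, dy_eq hO (hv.clm_apply contDiffOn_const) h1 hp, fderiv_apply_const hO hv hp,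
      vderiv_vderiv_comm hO hs hp, vderiv_apply]
  have hbasis : ∀ i j : Fin n, vderiv (vderiv (pairing b)) p (Pi.single i 1) (Pi.single j 1)
      = ρ p.1 p.2 / L p.1 p.2 ^ 3 * (2 * energy L p * metricForm L p (Pi.single i 1) (Pi.single j 1)
      - vderiv (energy L) p (Pi.single i 1) * vderiv (energy L) p (Pi.single j 1)) := fun i j => by
    have hv := contDiffOn_vderiv hO hb.pairing_smooth
    rw [vderiv_apply, ← fderiv_apply_const hO hv hp,
      fderiv_congr_of_isOpen hO (fun q hq => hb.vderiv_pairing_single hL hq j) hp,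
      hb.fderiv_component hL hp, hL1 _ p hp, hL1 _ p hp, hL2]
    have h := (hρ p.1 p.2 hp).2 j i
    rw [hang] at h
    rw [eq_div_of_mul_eq hLp.ne' ((mul_comm _ _).trans h), energy]
    field_simp
    ring
  refine ⟨ρ p.1 p.2 / L p.1 p.2 ^ 3, fun a c => ?_⟩
  rw [bilin_eq_sum (vderiv (vderiv (pairing b)) p), bilin_eq_sum (metricForm L p),
    clm_eq_sum (vderiv (energy L) p) a, clm_eq_sum (vderiv (energy L) p) c, Finset.sum_mul_sum,
    Finset.mul_sum, ← Finset.sum_sub_distrib, Finset.mul_sum]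
  refine Finset.sum_congr rfl fun i _ => ?_
  rw [Finset.mul_sum, ← Finset.sum_sub_distrib, Finset.mul_sum]
  refine Finset.sum_congr rfl fun j _ => ?_
  rw [hbasis]
  simp only [smul_eq_mul]
  ring

/-- For a gradient, `δ_j b_i` is symmetric. -/
lemma fderiv_vderiv_pairing_hlift (hgrad : IsGradient D L b) (hp : p ∈ D) (a c : Vec n) :
    fderiv ℝ (vderiv (pairing b)) p (hlift L p a) c
      = fderiv ℝ (vderiv (pairing b)) p (hlift L p c) a := by
  have hO := hL.isOpen
  have hv := contDiffOn_vderiv hO hb.pairing_smooth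
  have key : ∀ i j : Fin n, fderiv ℝ (vderiv (pairing b)) p (hlift L p (Pi.single j 1))
      (Pi.single i 1) = hCov L b i j p.1 p.2 + ∑ r, cartanF L r i j p.1 p.2 * b p.1 p.2 r := by
    intro i j
    have h := hL.delta_eq (f := fun x y => b x y i) (hv.clm_apply contDiffOn_const)
      (fun q hq => (hb.vderiv_pairing_single hL hq i).symm) hp j
    rw [fderiv_apply_const hO hv hp] at h
    rw [← h, hCov, delta]
    simp only [mul_comm (dy _ _ _ _)]
    ring
  have hsymm : ∀ i j : Fin n, fderiv ℝ (vderiv (pairing b)) p (hlift L p (Pi.single j 1))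
      (Pi.single i 1) = fderiv ℝ (vderiv (pairing b)) p (hlift L p (Pi.single i 1))
      (Pi.single j 1) := fun i j => by
    rw [key, key, hgrad p.1 p.2 hp i j]
    congr 1
    exact Finset.sum_congr rfl fun r _ => by rw [hL.cartanF_symm hp]
  have e1 := bilin_eq_sum ((fderiv ℝ (vderiv (pairing b)) p).comp (hlift L p)) a c
  have e2 := bilin_eq_sum ((fderiv ℝ (vderiv (pairing b)) p).comp (hlift L p)) c a
  simp only [ContinuousLinearMap.comp_apply] at e1 e2
  rw [e1, e2, Finset.sum_comm]
  refine Finset.sum_congr rfl fun i _ => Finset.sum_congr rfl fun j _ => ?_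
  rw [hsymm]
  ring

/-- `β` satisfies the Euler–Lagrange equation along the spray in every direction annihilated by
the gradient h-vector `b`. -/
lemma isStationary_pairing (hgrad : IsGradient D L b) (hp : p ∈ D) {ν : Vec n}
    (hν : ∑ i, b p.1 p.2 i * ν i = 0) : IsStationary (pairing b) p (sprayDir L p) ν := by
  have hO := hL.isOpen
  have hv := contDiffOn_vderiv hO hb.pairing_smooth
  have h1 : ∀ q ∈ D, vdir ν (pairing b) q = vderiv (pairing b) q ν := fun q _ =>
    (vderiv_apply ν).symm
  refine ⟨by rw [h1 p hp, hb.vderiv_pairing hL hp, hν], ?_⟩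
  rw [fderiv_congr_of_isOpen hO h1 hp, fderiv_apply_const hO hv hp, ← hL.hlift_self hp,
    hb.fderiv_vderiv_pairing_hlift hL hgrad hp]
  -- differentiate `∂̇_y β = β` in the direction of the horizontal lift of `ν`
  have d := ((hasFDerivAt_of_smooth hO hv hp).clm_apply hasFDerivAt_snd).fderiv
  have e := congrArg (fun l : Vec n × Vec n →L[ℝ] ℝ => l (hlift L p ν))
    (d.symm.trans (fderiv_congr_of_isOpen hO (fun q hq => hb.pairing_eq hL hq) hp))
  simp at e
  have hs : fderiv ℝ (pairing b) p (ν, -connForm L p ν) = fderiv ℝ (pairing b) p (ν, 0)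
      - fderiv ℝ (pairing b) p (0, connForm L p ν) := by
    rw [← map_sub]; simp
  rw [hs] at e
  rw [hlift_apply]
  have hs' : fderiv ℝ (pairing b) p (0, -connForm L p ν)
      = -fderiv ℝ (pairing b) p (0, connForm L p ν) := by
    rw [show ((0 : Vec n), -connForm L p ν) = -((0 : Vec n), connForm L p ν) by simp, map_neg]
  linarith

/-- `β` is transversally flat whenever the energy is and `b` annihilates the normal. -/
lemma isTransversallyFlat_pairing (hp : p ∈ D) {ν : Vec n} {T : Set (Vec n)}
    (hE : IsTransversallyFlat (energy L) p T ν) (hν : metricForm L p ν ν = 1)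
    (hbν : ∑ i, b p.1 p.2 i * ν i = 0) : IsTransversallyFlat (pairing b) p T ν := by
  have hO := hL.isOpen
  have hEs := hL.energy_smooth
  have hβ := hb.pairing_smooth
  have hpos : energy L p ≠ 0 := by
    have := hL.pos p.1 p.2 hp
    rw [energy]; positivity
  have h1 : vdir ν (pairing b) p = 0 := by
    rw [vdir, ← vderiv_apply, hb.vderiv_pairing hL hp, hbν]
  -- `k a` is `L² h(ν, a)`
  let k : Vec n → Vec n × Vec n → ℝ := fun a =>
    (fun _ => 2) * (energy L * vdir a (vdir ν (energy L)))
      + (fun _ => -1) * (vdir a (energy L) * vdir ν (energy L))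
  have hσ : ∀ q ∈ D, ∃ σ : ℝ, ∀ a, vdir a (vdir ν (pairing b)) q = σ * k a q := fun q hq => by
    obtain ⟨σ, h⟩ := hb.exists_vderiv_vderiv_pairing hL hq
    refine ⟨σ, fun a => ?_⟩
    rw [← vderiv_vderiv_eq_vdir hO hβ hq, h, metricForm, vderiv_vderiv_eq_vdir hO hEs hq,
      vderiv_apply, vderiv_apply]
    simp only [k, Pi.add_apply, Pi.mul_apply, vdir]
    ring
  have hk : ∀ a, ContDiffOn ℝ ∞ (k a) D := fun a =>
    (contDiffOn_const.mul (hEs.mul (vdir_smooth hO (vdir_smooth hO hEs ν) a))).add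
      (contDiffOn_const.mul ((vdir_smooth hO hEs a).mul (vdir_smooth hO hEs ν)))
  have hka : ∀ a ∈ T, k a p = 0 := fun a ha => by
    simp [k, hE.first, hE.second a ha]
  have hkν : k ν p ≠ 0 := by
    have : vdir ν (vdir ν (energy L)) p = 1 := by
      rw [← vderiv_vderiv_eq_vdir hO hEs hp]; exact hν
    simp [k, hE.first, this, hpos]
  have hkab : ∀ a ∈ T, ∀ c ∈ T, vdir c (k a) p = 0 := fun a ha c hc => by
    have s1 := contDiffOn_mul hEs (vdir_smooth hO (vdir_smooth hO hEs ν) a)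
    have s2 := contDiffOn_mul (vdir_smooth hO hEs a) (vdir_smooth hO hEs ν)
    have z : ∀ x : ℝ, vdir c (fun _ => x) p = 0 := fun x => by simp [vdir]
    rw [vdir_add hO (contDiffOn_mul contDiffOn_const s1)
        (contDiffOn_mul contDiffOn_const s2) c p hp,
      vdir_mul hO contDiffOn_const s1 c p hp, vdir_mul hO contDiffOn_const s2 c p hp,
      vdir_mul hO hEs (vdir_smooth hO (vdir_smooth hO hEs ν) a) c p hp,
      vdir_mul hO (vdir_smooth hO hEs a) (vdir_smooth hO hEs ν) c p hp, z, z,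
      hE.first, hE.second a ha, hE.second c hc, hE.third a ha c hc]
    ring
  obtain ⟨σ, hσp⟩ := hσ p hp
  have h2 : ∀ a ∈ T, vdir a (vdir ν (pairing b)) p = 0 := fun a ha => by
    rw [hσp, hka a ha, mul_zero]
  refine ⟨h1, h2, fun a ha c hc => ?_⟩
  -- the factor of proportionality is eliminated before differentiating
  have hrel : ∀ q ∈ D, (vdir a (vdir ν (pairing b)) * k ν) q
      = (vdir ν (vdir ν (pairing b)) * k a) q := fun q hq => by
    obtain ⟨σ, h⟩ := hσ q hq
    simp only [Pi.mul_apply, h]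
    ring
  have e := vdir_congr hO hrel c p hp
  rw [vdir_mul hO (vdir_smooth hO (vdir_smooth hO hβ ν) a) (hk ν) c p hp,
    vdir_mul hO (vdir_smooth hO (vdir_smooth hO hβ ν) ν) (hk a) c p hp, h2 a ha, hka a ha,
    hkab a ha c hc] at e
  simpa [hkν] using e

end IsHVector

end HVector

/-! ### The Kropina change -/

section Kropina

variable {m : ℕ} {D : Set (Vec (m + 1) × Vec (m + 1))} {L : ScalarField (m + 1)}
  {b : Vec (m + 1) → Vec (m + 1) → Vec (m + 1)}
  {U : Set (Vec m)} {X : Vec m → Vec (m + 1)} {N Ns : Vec m → Vec m → Vec (m + 1)}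

/-- The Kropina change by a tangent gradient h-vector preserves the vanishing of the normal
curvature and of the second fundamental v-tensor. -/
theorem IsFlatAlong.kropina (h : IsFlatAlong L D U X N) (hL : IsFinslerMetric D L)
    (hb : IsHVector D L b) (hLs : IsFinslerMetric D (kropina L b)) (hX : IsHypersurface U X)
    (hN : IsUnitNormal L D U X N) (hNs : IsUnitNormal (Finsler.kropina L b) D U X Ns)
    (hgrad : IsGradient D L b) (htan : ∀ u v, (u, v) ∈ lineElements D U X →
      ∑ i, b (X u) (push X u v) i * N u v i = 0) :
    IsFlatAlong (Finsler.kropina L b) D U X Ns := by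
  have hO := hL.isOpen
  have hE := hL.energy_smooth
  have hβ := hb.pairing_smooth
  have hβ0 : ∀ p ∈ D, pairing b p ≠ 0 := fun p hp h0 => by
    have h1 := hLs.pos p.1 p.2 hp
    have h2 : Finsler.kropina L b p.1 p.2 = L p.1 p.2 ^ 2 / pairing b p := rfl
    rw [h2, h0, div_zero] at h1
    exact lt_irrefl _ h1
  -- with `θ = E/β` the new energy is `2θ²`
  let θ : Vec (m + 1) × Vec (m + 1) → ℝ := fun p => energy L p / pairing b p
  have hθ : ContDiffOn ℝ ∞ θ D := hE.div hβ hβ0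
  have hθβ : ∀ p ∈ D, energy L p = (θ * pairing b) p := fun p hp => by
    simp only [θ, Pi.mul_apply]
    rw [div_mul_cancel₀ _ (hβ0 p hp)]
  have hEs : ∀ p ∈ D, ((fun _ => 2) * (θ * θ) : Vec (m + 1) × Vec (m + 1) → ℝ) p
      = energy (Finsler.kropina L b) p := fun p hp => by
    have h2 : Finsler.kropina L b p.1 p.2 = L p.1 p.2 ^ 2 / pairing b p := rfl
    have := hβ0 p hp
    simp only [energy, h2, θ, Pi.mul_apply]
    field_simp
  have hfirst : ∀ q ∈ lineElements D U X,
      vdir (N q.1 q.2) (energy L) (liftElement X q) = 0 := fun q hq => by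
    rw [vdir, ← vderiv_apply, ← hL.metricForm_self (hX.mem_lineElements.1 hq).2]
    exact hN.metricForm_tangent hL hX hq q.2
  have hbN : ∀ q ∈ lineElements D U X,
      ∑ i, b (liftElement X q).1 (liftElement X q).2 i * N q.1 q.2 i = 0 := fun q hq => by
    have := htan q.1 q.2 hq
    rwa [hX.push_eq hq.1] at this
  have hflat : ∀ q ∈ lineElements D U X, IsTransversallyFlat (energy (Finsler.kropina L b))
      (liftElement X q) (Set.range (fderiv ℝ X q.1)) (N q.1 q.2) := fun q hq => by
    have hp := (hX.mem_lineElements.1 hq).2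
    have hEf : IsTransversallyFlat (energy L) (liftElement X q) (Set.range (fderiv ℝ X q.1))
        (N q.1 q.2) := by
      refine ⟨hfirst q hq, ?_, ?_⟩
      · rintro _ ⟨w, rfl⟩
        rw [← vderiv_vderiv_eq_vdir hO hE hp]
        exact hN.metricForm_tangent hL hX hq w
      · rintro _ ⟨w, rfl⟩ _ ⟨w', rfl⟩
        rw [← vderiv_vderiv_vderiv_eq_vdir hO hE hp]
        exact h.cartan q hq w' w
    have hβf := hb.isTransversallyFlat_pairing hL hp hEf (hN.metricForm_normal hL hX hq) (hbN q hq)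
    have hθf := IsTransversallyFlat.of_mul hO hθ hβ hp hβf (hβ0 _ hp) (hEf.congr hO hθβ hp)
    have hc : IsTransversallyFlat (fun _ => (2 : ℝ)) (liftElement X q)
        (Set.range (fderiv ℝ X q.1)) (N q.1 q.2) := by
      have z : ∀ (c : Vec (m + 1)) (x : ℝ), vdir c (fun _ => x) = fun _ => 0 := fun c x => by
        ext p; simp [vdir]
      exact ⟨by simp [z], fun a _ => by simp [z], fun a _ c _ => by simp [z]⟩
    exact (hc.mul hO contDiffOn_const (hθ.mul hθ) hp (hθf.mul hO hθ hθ hp hθf)).congr hO hEs hp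
  have hstat : ∀ q ∈ lineElements D U X, IsStationary (energy (Finsler.kropina L b))
      (liftElement X q) (sprayDir L (liftElement X q)) (N q.1 q.2) := fun q hq => by
    have hp := (hX.mem_lineElements.1 hq).2
    have hEf : IsStationary (energy L) (liftElement X q) (sprayDir L (liftElement X q))
        (N q.1 q.2) := by
      refine ⟨hfirst q hq, ?_⟩
      exact hL.fderiv_vdir_energy_sprayDir hp _
    have hβf := hb.isStationary_pairing hL hgrad hp (hbN q hq)
    have hθf := IsStationary.of_mul hO hθ hβ hp hβf (hβ0 _ hp) (hEf.congr hO hθβ hp)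
    have hc : IsStationary (fun _ => (2 : ℝ)) (liftElement X q)
        (sprayDir L (liftElement X q)) (N q.1 q.2) := by
      have z : ∀ (c : Vec (m + 1)) (x : ℝ), vdir c (fun _ => x) = fun _ => 0 := fun c x => by
        ext p; simp [vdir]
      exact ⟨by simp [z], by simp [z]⟩
    exact (hc.mul hO contDiffOn_const (hθ.mul hθ) hp (hθf.mul hO hθ hθ hp hθf)).congr hO hEs hp
  have hEss := hLs.energy_smooth
  -- the two normals are proportional
  have hnormal : ∀ q ∈ lineElements D U X, ∃ μ : ℝ, Ns q.1 q.2 = μ • N q.1 q.2 := fun q hq => by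
    have hp := (hX.mem_lineElements.1 hq).2
    obtain ⟨w, hw⟩ := hN.exists_decomposition hL hX hq (Ns q.1 q.2)
    have hz : fderiv ℝ X q.1 w = 0 := by
      refine hNs.eq_zero_of_orthogonal hLs hX hq (hNs.metricForm_tangent hLs hX hq w) fun w' => ?_
      have e1 := hNs.metricForm_tangent hLs hX hq w'
      have e2 : metricForm (Finsler.kropina L b) (liftElement X q) (fderiv ℝ X q.1 w')
          (N q.1 q.2) = 0 := by
        rw [metricForm, vderiv_vderiv_eq_vdir hO hEss hp]
        exact (hflat q hq).second _ ⟨w', rfl⟩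
      rw [hw, map_add, map_smul, e2, smul_zero, add_zero] at e1
      rw [hLs.metricForm_symm hp, e1]
    exact ⟨_, hw.trans (by rw [hz, zero_add])⟩
  refine isFlatAlong_of_spray hLs hX hNs (fun q hq => hNs.exists_tangent hLs hX hq ?_)
    fun q hq w w' => ?_
  · have hp := (hX.mem_lineElements.1 hq).2
    obtain ⟨μ, hμ⟩ := hnormal q hq
    obtain ⟨z, hz⟩ := h.tangent q hq q.2
    have hG : connForm L (liftElement X q) (fderiv ℝ X q.1 q.2)
        = (2 : ℝ) • sprayVec L (liftElement X q) := hL.connForm_self hp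
    have e1 := hLs.fderiv_vdir_energy_sprayDir hp (N q.1 q.2)
    have e2 := (hstat q hq).second
    have e3 : metricForm (Finsler.kropina L b) (liftElement X q) (fderiv ℝ X q.1 z) (N q.1 q.2)
        = 0 := by
      rw [metricForm, vderiv_vderiv_eq_vdir hO hEss hp]
      exact (hflat q hq).second _ ⟨z, rfl⟩
    have e4 : fderiv ℝ (vdir (N q.1 q.2) (energy (Finsler.kropina L b))) (liftElement X q)
        (sprayDir (Finsler.kropina L b) (liftElement X q) - sprayDir L (liftElement X q)) = 0 := by
      rw [map_sub, e1, e2, sub_self]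
    have e5 : sprayDir (Finsler.kropina L b) (liftElement X q) - sprayDir L (liftElement X q)
        = (0, (2 : ℝ) • sprayVec L (liftElement X q)
          - (2 : ℝ) • sprayVec (Finsler.kropina L b) (liftElement X q)) := by
      simp only [sprayDir, Prod.mk_sub_mk, sub_self]
      congr 1
      abel
    rw [e5] at e4
    have e6 : metricForm (Finsler.kropina L b) (liftElement X q)
        ((2 : ℝ) • sprayVec L (liftElement X q)
          - (2 : ℝ) • sprayVec (Finsler.kropina L b) (liftElement X q)) (N q.1 q.2) = 0 := by
      rw [metricForm, vderiv_vderiv_eq_vdir hO hEss hp]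
      exact e4
    rw [hG] at hz
    rw [← hz, map_add, add_apply] at e3
    rw [map_sub, sub_apply] at e6
    rw [hμ, map_smul, map_add, add_apply, smul_eq_mul]
    rw [show ∀ x y z : ℝ, μ * (x + y) = μ * ((x + z) - (z - y)) by intros; ring, e3, e6]
    ring
  · have hp := (hX.mem_lineElements.1 hq).2
    obtain ⟨μ, hμ⟩ := hnormal q hq
    have e : cartanForm (Finsler.kropina L b) (liftElement X q) (fderiv ℝ X q.1 w)
        (fderiv ℝ X q.1 w') (N q.1 q.2) = 0 := by
      rw [cartanForm, metricForm, vderiv_vderiv_vderiv_eq_vdir hO hEss hp]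
      exact (hflat q hq).third _ ⟨w', rfl⟩ _ ⟨w, rfl⟩
    rw [hμ, map_smul, e, smul_zero]

end Kropina

end Finsler

end

theorem mainTheorem3 (m : ℕ)
    (D : Set (Finsler.Vec (m + 1) × Finsler.Vec (m + 1)))
    (L : Finsler.ScalarField (m + 1))
    (b : Finsler.Vec (m + 1) → Finsler.Vec (m + 1) → Finsler.Vec (m + 1))
    (hL : Finsler.IsFinslerMetric D L)
    (hb : Finsler.IsHVector D L b)
    (hLs : Finsler.IsFinslerMetric D (Finsler.kropina L b))
    (U : Set (Finsler.Vec m)) (X : Finsler.Vec m → Finsler.Vec (m + 1))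
    (hX : Finsler.IsHypersurface U X)
    (N Ns : Finsler.Vec m → Finsler.Vec m → Finsler.Vec (m + 1))
    (hN : Finsler.IsUnitNormal L D U X N)
    (hNs : Finsler.IsUnitNormal (Finsler.kropina L b) D U X Ns)
    (hgrad : Finsler.IsGradient D L b)
    (htan : ∀ u v, (u, v) ∈ Finsler.lineElements D U X →
      ∑ i, b (X u) (Finsler.push X u v) i * N u v i = 0)
    (hC : ∀ x y, (x, y) ∈ D → ∀ i j,
      ∑ r, (∑ k, Finsler.hCov L b r k x y * y k) * Finsler.cartanCUp L r i j x y = 0) :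
    (Finsler.IsHyperplaneSecondKind L D U X N →
      (∀ u v, (u, v) ∈ Finsler.lineElements D U X → ∀ α β,
        Finsler.vTensor L X N α β u v = 0) →
      Finsler.IsHyperplaneSecondKind (Finsler.kropina L b) D U X Ns) ∧
    (Finsler.IsHyperplaneThirdKind L D U X N →
      Finsler.IsHyperplaneThirdKind (Finsler.kropina L b) D U X Ns) := by
  refine ⟨fun h hM => ?_, fun h => ?_⟩
  · exact ((h.isFlatAlong hL hX hN hM).kropina hL hb hLs hX hN hNs hgrad
      htan).isHyperplaneSecondKind hLs hX hNs
  · exact ((h.isFlatAlong hL hX hN).kropina hL hb hLs hX hN hNs hgrad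
      htan).isHyperplaneThirdKind hLs hX hNs
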